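/- For a matroid $M$ on a finite ground set $E$, let $\mathscr{P}(M)\subseteq\mathbb{R}^E$ be its basis polytope, that is, the convex hull of the indicator vectors $e_B$ of the bases $B$ of $M$. A polynomial $p\in\mathbb{Q}[t]$ is the Ehrhart polynomial of $M$, written $p(t)=\operatorname{ehr}(M,t)$, if $p(t)=\#\bigl(t\mathscr{P}(M)\cap\mathbb{Z}^E\bigr)$ for every integer $t\ge 0$ (there is at most one such polynomial). A polynomial is said to have positive coefficients if all its coefficients, from the constant one up to the leading one, are positive; in particular it is not zero. The matroid $M$ is Ehrhart positive if it has an Ehrhart polynomial and this polynomial has positive coefficients. Let $U_{2,n}$ be the uniform matroid of rank $2$ on $n$ elements, whose bases are all the $2$-subsets. Let $T_{2,n}$ be a minimal matroid of rank $2$ on $n$ elements, i.e. a connected matroid (one that is not a direct sum of two matroids with nonempty ground sets) of rank $2$ with $n$ elements that has the smallest number of bases among all such matroids. A matroid of rank $k$ is paving if all its circuits have at least $k$ elements, and sparse paving if both it and its dual are paving. (1) For every integer $n\ge 3$ (and every choice of $T_{2,n}$), the Ehrhart polynomials of $U_{2,n}$ and $T_{2,n}$ exist and the polynomial $$P_n(t)=\operatorname{ehr}(U_{2,n},t)-\left\lfloor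 \tfrac n2\right\rfloor \operatorname{ehr}(T_{2,n},t-1)$$ has positive coefficients. (2) Every sparse paving matroid of rank $2$ on a finite ground set is Ehrhart positive. -/

import Mathlib

open scoped Pointwise Matroid

/-! ### Matroids -/

/-- The uniform matroid of rank `k` on `{0, …, n - 1}`: the bases are all the `k`-subsets. -/
noncomputable def uniformMatroid (k n : ℕ) (hk : k ≤ n) : Matroid (Fin n) :=
  Matroid.ofIsBaseOfFinite (E := Set.univ) Set.finite_univ (fun B => B.ncard = k)
    (by
      obtain ⟨s, -, hs⟩ := Finset.exists_subset_card_eq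
        (s := (Finset.univ : Finset (Fin n))) (n := k) (by simpa using hk)
      exact ⟨(s : Set (Fin n)), by rw [Set.ncard_coe_finset, hs]⟩)
    (by
      intro B₁ B₂ h₁ h₂ a ha
      have hlt : (B₁ \ {a}).ncard < B₂.ncard := by
        have := Set.ncard_sdiff_singleton_lt_of_mem ha.1 (Set.toFinite B₁)
        omega
      obtain ⟨b, hb, hb'⟩ := Set.exists_mem_notMem_of_ncard_lt_ncard hlt
      have hba : b ≠ a := fun h => ha.2 (h ▸ hb)
      have hb₁ : b ∉ B₁ := fun h => hb' ⟨h, hba⟩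
      refine ⟨b, ⟨hb, hb₁⟩, ?_⟩
      exact (Set.ncard_exchange hb₁ ha.1).trans h₁)
    (fun _ _ => Set.subset_univ _)

/-- A matroid is connected if it is not a direct sum of two matroids with nonempty ground sets. -/
def MatroidConnected {α : Type*} (M : Matroid α) : Prop :=
  ∀ (M₁ M₂ : Matroid α) (h : Disjoint M₁.E M₂.E),
    M = M₁.disjointSum M₂ h → M₁.E = ∅ ∨ M₂.E = ∅

/-- `M` is a connected matroid of rank `k` on all of `{0, …, n - 1}`. -/
def IsConnectedOfRank (k n : ℕ) (M : Matroid (Fin n)) : Prop :=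
  M.E = Set.univ ∧ M.eRank = (k : ℕ∞) ∧ MatroidConnected M

/-- `T` is (a copy on `{0, …, n - 1}` of) the minimal matroid `T_{k,n}`: a connected matroid of
rank `k` with `n` elements that has the least number of bases among all such matroids. -/
def IsMinimalMatroid (k n : ℕ) (T : Matroid (Fin n)) : Prop :=
  IsConnectedOfRank k n T ∧
    ∀ M : Matroid (Fin n), IsConnectedOfRank k n M →
      {B | T.IsBase B}.ncard ≤ {B | M.IsBase B}.ncard

/-- Every circuit has at least as many elements as the rank of the matroid. -/
def IsPaving {α : Type*} (M : Matroid α) : Prop :=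
  ∀ C : Set α, M.IsCircuit C → M.eRank ≤ C.encard

/-- A matroid is sparse paving if it and its dual are paving. -/
def IsSparsePaving {α : Type*} (M : Matroid α) : Prop :=
  IsPaving M ∧ IsPaving M✶

/-! ### Basis polytopes and Ehrhart polynomials -/

/-- The basis polytope of `M`, in the space `ℝ^E` on the ground set `E` of `M`: the convex hull
of the indicator vectors of the bases. -/
def basisPolytope {α : Type*} (M : Matroid α) : Set (M.E → ℝ) :=
  convexHull ℝ
    {x | ∃ B : Set α, M.IsBase B ∧ x = Set.indicator {i : M.E | (i : α) ∈ B} (fun _ => (1 : ℝ))}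

/-- `p` is the Ehrhart polynomial of the lattice polytope `P`: for all integers `t ≥ 0`, `p(t)` is
the number of lattice points in the dilation `tP`. -/
def IsEhrhartPolynomial {ι : Type*} (P : Set (ι → ℝ)) (p : Polynomial ℚ) : Prop :=
  ∀ t : ℕ, p.eval (t : ℚ) =
    (({z : ι → ℤ | (fun i => (z i : ℝ)) ∈ (t : ℝ) • P}.ncard : ℕ) : ℚ)

/-- A polytope has at most one Ehrhart polynomial. -/
theorem IsEhrhartPolynomial.unique {ι : Type*} {P : Set (ι → ℝ)} {p q : Polynomial ℚ}
    (hp : IsEhrhartPolynomial P p) (hq : IsEhrhartPolynomial P q) : p = q := by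
  refine Polynomial.eq_of_infinite_eval_eq p q
    ((Set.infinite_range_of_injective (Nat.cast_injective (R := ℚ))).mono ?_)
  rintro _ ⟨t, rfl⟩
  exact (hp t).trans (hq t).symm

/-- All the coefficients of `p`, from the constant to the leading one, are positive. In particular
`p` is not zero. -/
def HasPositiveCoeffs (p : Polynomial ℚ) : Prop :=
  ∀ i ≤ p.natDegree, 0 < p.coeff i

/-- The basis polytope of `M` has an Ehrhart polynomial, and its coefficients are positive. -/
def IsEhrhartPositive {α : Type*} (M : Matroid α) : Prop :=
  ∃ p : Polynomial ℚ, IsEhrhartPolynomial (basisPolytope M) p ∧ HasPositiveCoeffs p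

/-! ### Minimal matroids exist -/

theorem uniformMatroid_indep (k n : ℕ) (hk : k ≤ n) (I : Set (Fin n)) :
    (uniformMatroid k n hk).Indep I ↔ I.ncard ≤ k := by
  rw [Matroid.indep_iff]
  constructor
  · rintro ⟨B, hB, hIB⟩
    have hB' : B.ncard = k := hB
    exact hB' ▸ Set.ncard_le_ncard hIB (Set.toFinite B)
  · intro h
    obtain ⟨B, hIB, -, hB⟩ := Set.exists_subsuperset_card_eq (Set.subset_univ I) h
      (by simpa [Set.ncard_univ] using hk)
    exact ⟨B, hB, hIB⟩

theorem uniformMatroid_connected (k n : ℕ) (hk : 0 < k) (hkn : k < n) :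
    IsConnectedOfRank k n (uniformMatroid k n hkn.le) := by
  refine ⟨rfl, ?_, ?_⟩
  · obtain ⟨B, hB⟩ := (uniformMatroid k n hkn.le).exists_isBase
    have hB' : B.ncard = k := hB
    rw [← hB.encard_eq_eRank, ← (Set.toFinite B).cast_ncard_eq, hB']
  · intro M₁ M₂ hd hM
    by_contra hne
    push Not at hne
    obtain ⟨⟨e, he⟩, ⟨f, hf⟩⟩ := hne
    have hef : e ≠ f := fun h => hd.ne_of_mem he hf h
    have hpair : ({e, f} : Set (Fin n)).ncard = 2 := Set.ncard_pair hef
    obtain ⟨C, hC, -, hCc⟩ := Set.exists_subsuperset_card_eq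
      (Set.subset_univ ({e, f} : Set (Fin n))) (n := k + 1) (by omega)
      (by simpa [Set.ncard_univ] using hkn)
    have heC : e ∈ C := hC (by simp)
    have hfC : f ∈ C := hC (by simp)
    have key : ∀ g ∈ C, (M₁.disjointSum M₂ hd).Indep (C \ {g}) := by
      intro g hg
      rw [← hM, uniformMatroid_indep]
      rw [Set.ncard_sdiff_singleton_of_mem hg]
      omega
    have h1 := (Matroid.disjointSum_indep_iff.1 (key f hfC)).1
    have h2 := (Matroid.disjointSum_indep_iff.1 (key e heC)).2.1
    have hE : C ⊆ M₁.E ∪ M₂.E := by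
      rw [← Matroid.disjointSum_ground_eq (h := hd), ← hM]
      exact Set.subset_univ _
    have hfM : f ∉ M₁.E := fun h => hd.ne_of_mem h hf rfl
    have heM : e ∉ M₂.E := fun h => hd.ne_of_mem he h rfl
    have e1 : (C \ {f}) ∩ M₁.E = C ∩ M₁.E := by
      ext x; simp only [Set.mem_inter_iff, Set.mem_sdiff, Set.mem_singleton_iff]
      exact ⟨fun h => ⟨h.1.1, h.2⟩, fun h => ⟨⟨h.1, fun hx => hfM (hx ▸ h.2)⟩, h.2⟩⟩
    have e2 : (C \ {e}) ∩ M₂.E = C ∩ M₂.E := by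
      ext x; simp only [Set.mem_inter_iff, Set.mem_sdiff, Set.mem_singleton_iff]
      exact ⟨fun h => ⟨h.1.1, h.2⟩, fun h => ⟨⟨h.1, fun hx => heM (hx ▸ h.2)⟩, h.2⟩⟩
    rw [e1] at h1
    rw [e2] at h2
    have hCi : (M₁.disjointSum M₂ hd).Indep C := Matroid.disjointSum_indep_iff.2 ⟨h1, h2, hE⟩
    rw [← hM, uniformMatroid_indep] at hCi
    omega

theorem exists_isMinimalMatroid (k n : ℕ) (hk : 0 < k) (hkn : k < n) :
    ∃ T : Matroid (Fin n), IsMinimalMatroid k n T := by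
  obtain ⟨T, hT, hmin⟩ := exists_minimalFor_of_wellFoundedLT
    (fun M : Matroid (Fin n) => IsConnectedOfRank k n M)
    (fun M => {B | M.IsBase B}.ncard) ⟨_, uniformMatroid_connected k n hk hkn⟩
  refine ⟨T, hT, fun M hM => ?_⟩
  rcases le_total {B | T.IsBase B}.ncard {B | M.IsBase B}.ncard with h | h
  · exact h
  · exact hmin hM h

/-! A loopless matroid of rank 2 is a partition of its ground set into parallel classes, its bases
being the pairs that meet two classes. So the problem is one about colourings `c`: the lattice
points of the t-th dilate are the nonnegative integer vectors of total 2t with every colour sum at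
most t (`ncard_smul_pairPolytope`). For U_{2,n} all colours differ; T_{2,n} has exactly three
classes, two of them singletons (`exists_singleton_colours`); in a sparse paving matroid classes
have at most two elements.

The two halves meet as follows. Going from distinct colours to m double classes removes, for each
class {a, b}, the points with z a + z b > t, and no point is removed twice. Subtracting e_a + e_b
identifies the removed points with those of the (t-1)-st dilate for T_{2,n}
(`card_rankTwoPoints_filter_lt`). For n ≥ 3 the sparse paving matroid thus has polynomial
ehr(U_{2,n}, t) - m ehr(T_{2,n}, t-1) with m ≤ ⌊n/2⌋, and P_n is the extreme case. Since
ehr(T_{2,n}, t-1) has nonnegative coefficients, smaller m follow from P_n.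

Positivity of P_n comes from closed product formulas and a coefficientwise comparison of two
products of linear factors (`ehrUniform_sub_eq`, `posUpTo_ehrUniform_sub`). -/

/-! ### The Ehrhart polynomials as explicit products, and positivity of their coefficients. -/

section Positivity

open Polynomial

/-- `p` has degree at most `d` and its coefficients up to the one of degree `d` are positive. -/
def PosUpTo (d : ℕ) (p : ℚ[X]) : Prop :=
  p.natDegree ≤ d ∧ ∀ i ≤ d, 0 < p.coeff i

/-- All the coefficients of `p` are nonnegative. -/
def NonnegCoeffs (p : ℚ[X]) : Prop :=
  ∀ i, 0 ≤ p.coeff i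

theorem PosUpTo.hasPositiveCoeffs {d : ℕ} {p : ℚ[X]} (h : PosUpTo d p) : HasPositiveCoeffs p :=
  fun i hi => h.2 i (hi.trans h.1)

theorem PosUpTo.nonneg {d : ℕ} {p : ℚ[X]} (h : PosUpTo d p) : NonnegCoeffs p := by
  intro i
  rcases le_or_gt i d with hi | hi
  · exact (h.2 i hi).le
  · rw [coeff_eq_zero_of_natDegree_lt (h.1.trans_lt hi)]

theorem PosUpTo.add {d : ℕ} {p q : ℚ[X]} (hp : PosUpTo d p) (hq : NonnegCoeffs q)
    (hd : q.natDegree ≤ d) : PosUpTo d (p + q) := by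
  refine ⟨natDegree_add_le_of_degree_le hp.1 hd, fun i hi => ?_⟩
  rw [coeff_add]
  exact add_pos_of_pos_of_nonneg (hp.2 i hi) (hq i)

theorem PosUpTo.mul {d e : ℕ} {p q : ℚ[X]} (hp : PosUpTo d p) (hq : PosUpTo e q) :
    PosUpTo (d + e) (p * q) := by
  refine ⟨natDegree_mul_le_of_le hp.1 hq.1, fun i hi => ?_⟩
  rw [coeff_mul]
  -- All terms are nonnegative, so one pair of indices within the ranges `d` and `e` is enough.
  refine Finset.sum_pos' (fun x _ => mul_nonneg (hp.nonneg _) (hq.nonneg _))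
    ⟨(min i d, i - min i d), ?_, ?_⟩
  · refine Finset.HasAntidiagonal.mem_antidiagonal.2 ?_
    dsimp only
    omega
  · exact mul_pos (hp.2 _ (min_le_right _ _)) (hq.2 _ (by omega))

theorem PosUpTo.linear {a b : ℚ} (ha : 0 < a) (hb : 0 < b) : PosUpTo 1 (C a * X + C b) := by
  refine ⟨natDegree_linear_le, fun i hi => ?_⟩
  interval_cases i <;> simp [ha, hb]

theorem PosUpTo.prod {f : ℕ → ℚ[X]} (hf : ∀ i, PosUpTo 1 (f i)) (N : ℕ) :
    PosUpTo N (∏ i ∈ Finset.range N, f i) := by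
  induction N with
  | zero => exact ⟨by simp, fun i hi => by simp [Nat.le_zero.1 hi]⟩
  | succ N ih =>
    rw [Finset.prod_range_succ]
    exact ih.mul (hf N)

theorem NonnegCoeffs.mul {p q : ℚ[X]} (hp : NonnegCoeffs p) (hq : NonnegCoeffs q) :
    NonnegCoeffs (p * q) := by
  intro i
  rw [coeff_mul]
  exact Finset.sum_nonneg fun x _ => mul_nonneg (hp _) (hq _)

theorem NonnegCoeffs.add {p q : ℚ[X]} (hp : NonnegCoeffs p) (hq : NonnegCoeffs q) :
    NonnegCoeffs (p + q) := by
  intro i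
  rw [coeff_add]
  exact add_nonneg (hp i) (hq i)

theorem NonnegCoeffs.C {a : ℚ} (ha : 0 ≤ a) : NonnegCoeffs (C a) := by
  intro i
  rw [coeff_C]
  split_ifs <;> simp [ha]

theorem NonnegCoeffs.X : NonnegCoeffs (X : ℚ[X]) := by
  intro i
  rw [coeff_X]
  split_ifs <;> simp

/-- Telescoping: Ff - Gg = (F - G)f + G(f - g). -/
theorem NonnegCoeffs.prod_sub_prod {f g : ℕ → ℚ[X]} (hf : ∀ i, NonnegCoeffs (f i))
    (hg : ∀ i, NonnegCoeffs (g i)) (hfg : ∀ i, NonnegCoeffs (f i - g i)) (N : ℕ) :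
    NonnegCoeffs (∏ i ∈ Finset.range N, f i - ∏ i ∈ Finset.range N, g i) := by
  have hprod : ∀ N, NonnegCoeffs (∏ i ∈ Finset.range N, g i) := by
    intro N
    induction N with
    | zero => simpa using NonnegCoeffs.C (zero_le_one)
    | succ N ih =>
      rw [Finset.prod_range_succ]
      exact ih.mul (hg N)
  induction N with
  | zero => intro i; simp
  | succ N ih =>
    have : ∏ i ∈ Finset.range (N + 1), f i - ∏ i ∈ Finset.range (N + 1), g i =
        (∏ i ∈ Finset.range N, f i - ∏ i ∈ Finset.range N, g i) * f N +
          (∏ i ∈ Finset.range N, g i) * (f N - g N) := by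
      rw [Finset.prod_range_succ, Finset.prod_range_succ]
      ring
    rw [this]
    exact (ih.mul (hf N)).add ((hprod N).mul (hfg N))

/-- The Ehrhart polynomial of the uniform matroid of rank `2` on `n` elements. -/
noncomputable def ehrUniform (n : ℕ) : ℚ[X] :=
  C (((n - 1).factorial : ℚ)⁻¹) *
    (∏ i ∈ Finset.range (n - 1), (C 2 * X + C (i + 1 : ℚ)) -
      C (n : ℚ) * ∏ i ∈ Finset.range (n - 1), (X + C (i : ℚ)))

/-- The Ehrhart polynomial of the minimal matroid of rank `2` on `n` elements, evaluated
at `X - 1`. -/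
noncomputable def ehrMinimalShift (n : ℕ) : ℚ[X] :=
  C (((n - 1).factorial : ℚ)⁻¹) *
    ((∏ i ∈ Finset.range (n - 2), (X + C (i : ℚ))) * (C ((n - 2 : ℕ) : ℚ) * X + C 1))

theorem ehrUniform_sub_three :
    ehrUniform 3 - C ((3 / 2 : ℕ) : ℚ) * ehrMinimalShift 3 = C 1 * X + C 1 := by
  simp only [ehrUniform, ehrMinimalShift, Finset.prod_range_succ, Finset.prod_range_zero]
  refine Polynomial.funext fun x => ?_
  simp
  ring

/-- Factors are scaled to constant term 1, so that the remaining product can be compared factor by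
factor with the one in `prod_add`. -/
theorem prod_two_mul_add (N : ℕ) :
    ∏ i ∈ Finset.range (N + 3), (C 2 * X + C (i + 1 : ℚ)) =
      C ((N + 3).factorial : ℚ) * ((C 2 * X + C 1) * (C 1 * X + C 1) * (C (2 / 3) * X + C 1) *
        ∏ i ∈ Finset.range N, (C (2 / (i + 4 : ℚ)) * X + C 1)) := by
  induction N with
  | zero =>
    refine Polynomial.funext fun x => ?_
    simp [Finset.prod_range_succ, Nat.factorial]
    ring
  | succ N ih =>
    have h : C 2 * X + C (((N + 3 : ℕ) : ℚ) + 1) =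
        C (N + 4 : ℚ) * (C (2 / (N + 4 : ℚ)) * X + C 1) := by
      rw [mul_add, ← mul_assoc, ← C_mul, ← C_mul, mul_div_cancel₀ _ (by positivity)]
      congr 2
      push_cast
      ring
    rw [show N + 1 + 3 = N + 3 + 1 from rfl, Finset.prod_range_succ, ih, Finset.prod_range_succ, h,
      Nat.factorial_succ (N + 3)]
    push_cast
    simp only [map_mul, map_add, map_one, map_natCast]
    simp only [C_ofNat]
    ring

theorem prod_add (N : ℕ) :
    ∏ i ∈ Finset.range (N + 2), (X + C (i : ℚ)) =
      C ((N + 1).factorial : ℚ) * (X * (C 1 * X + C 1) *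
        ∏ i ∈ Finset.range N, (C (1 / (i + 2 : ℚ)) * X + C 1)) := by
  induction N with
  | zero =>
    refine Polynomial.funext fun x => ?_
    simp [Finset.prod_range_succ]
  | succ N ih =>
    have h : X + C ((N + 2 : ℕ) : ℚ) =
        C (N + 2 : ℚ) * (C (1 / (N + 2 : ℚ)) * X + C 1) := by
      rw [mul_add, ← mul_assoc, ← C_mul, ← C_mul, mul_div_cancel₀ _ (by positivity)]
      simp
    rw [show N + 1 + 2 = N + 2 + 1 from rfl, Finset.prod_range_succ, ih, Finset.prod_range_succ, h,
      Nat.factorial_succ (N + 1)]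
    push_cast
    simp only [map_mul, map_add, map_one, map_natCast]
    simp only [C_ofNat]
    ring

/-- Let W and V be the two products over `range N` and L the linear factor. After removing X + 1,
the difference is (2X + 1)(2X/3 + 1)W - cXL·V with c = (N+1)!/(N+3)!. Adding and subtracting cXL·W
leaves a quadratic times W plus cXL(W - V), and each summand can be shown nonnegative separately. -/
theorem ehrUniform_sub_eq (N : ℕ) (f c : ℚ) (hc : c = 1 / ((N + 3) * (N + 2))) :
    ehrUniform (N + 4) - C f * ehrMinimalShift (N + 4) =
      (C 1 * X + C 1) *
        ((C (4 / 3 - c * (N + 4 + f * (N + 2))) * X ^ 2 +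
            C (8 / 3 - c * ((N + 4) * (N + 2) + f)) * X + C 1) *
          ∏ i ∈ Finset.range N, (C (2 / (i + 4 : ℚ)) * X + C 1) +
        C c * X * (C (N + 4 + f * (N + 2)) * X + C ((N + 4) * (N + 2) + f)) *
          (∏ i ∈ Finset.range N, (C (2 / (i + 4 : ℚ)) * X + C 1) -
            ∏ i ∈ Finset.range N, (C (1 / (i + 2 : ℚ)) * X + C 1))) := by
  have h1 := Finset.prod_range_succ (fun i : ℕ => X + C (i : ℚ)) (N + 2)
  have hne : ((N + 1).factorial : ℚ) ≠ 0 := by positivity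
  rw [ehrUniform, ehrMinimalShift, show N + 4 - 1 = N + 3 from rfl,
    show N + 4 - 2 = N + 2 from rfl, h1, prod_add, prod_two_mul_add]
  generalize ∏ i ∈ Finset.range N, (C (2 / (i + 4 : ℚ)) * X + C 1) = W
  generalize ∏ i ∈ Finset.range N, (C (1 / (i + 2 : ℚ)) * X + C 1) = V
  refine Polynomial.funext fun x => ?_
  simp only [eval_mul, eval_add, eval_sub, eval_C, eval_X, eval_pow]
  rw [Nat.factorial_succ (N + 2), Nat.factorial_succ (N + 1)]
  subst hc
  push_cast
  field_simp
  ring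

theorem PosUpTo.quadratic {a b c : ℚ} (ha : 0 < a) (hb : 0 < b) (hc : 0 < c) :
    PosUpTo 2 (C a * X ^ 2 + C b * X + C c) := by
  refine ⟨natDegree_quadratic_le, fun i hi => ?_⟩
  interval_cases i <;> simp [ha, hb, hc, coeff_X, coeff_C]

theorem PosUpTo.add_X_mul {d e : ℕ} {p q : ℚ[X]} (hp : PosUpTo d p) (hq : PosUpTo e q)
    (hd : d ≤ e + 1) : PosUpTo (e + 1) (p + X * q) := by
  refine ⟨natDegree_add_le_of_degree_le (hp.1.trans hd) ?_, fun i hi => ?_⟩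
  · rw [add_comm e]
    exact natDegree_mul_le_of_le natDegree_X_le hq.1
  · rw [coeff_add]
    cases i with
    | zero => simpa using hp.2 0 (Nat.zero_le _)
    | succ i =>
      rw [coeff_X_mul]
      exact add_pos_of_nonneg_of_pos (hp.nonneg _) (hq.2 i (by omega))

theorem PosUpTo.C_mul {d : ℕ} {p : ℚ[X]} {a : ℚ} (ha : 0 < a) (hp : PosUpTo d p) :
    PosUpTo d (C a * p) :=
  ⟨(natDegree_C_mul_le _ _).trans hp.1, fun i hi => by
    rw [coeff_C_mul]
    exact mul_pos ha (hp.2 i hi)⟩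

theorem posUpTo_ehrUniform_sub {n : ℕ} (hn : 5 ≤ n) :
    PosUpTo (n - 1) (ehrUniform n - C ((n / 2 : ℕ) : ℚ) * ehrMinimalShift n) := by
  obtain ⟨N, rfl⟩ : ∃ N, n = N + 4 := ⟨n - 4, by omega⟩
  have hN : (1 : ℚ) ≤ N := by exact_mod_cast (by omega : 1 ≤ N)
  have hf : (((N + 4) / 2 : ℕ) : ℚ) ≤ (N + 4) / 2 := by
    refine Nat.cast_div_le.trans ?_
    push_cast
    exact le_rfl
  rw [ehrUniform_sub_eq N _ _ rfl]
  set f : ℚ := (((N + 4) / 2 : ℕ) : ℚ)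
  have hf0 : 0 ≤ f := Nat.cast_nonneg _
  have hc : (0 : ℚ) < (N + 3) * (N + 2) := by positivity
  -- With f ≤ (N+4)/2 this reduces to (N+4)²/2 < (4/3)(N+3)(N+2), an equality at N = 0; hence n = 4
  -- is treated apart.
  have hA : 0 < 4 / 3 - 1 / ((N + 3) * (N + 2)) * (N + 4 + f * (N + 2)) := by
    rw [sub_pos, one_div_mul_eq_div, div_lt_iff₀ hc]
    nlinarith [mul_le_mul_of_nonneg_right hf (by positivity : (0 : ℚ) ≤ N + 2)]
  have hB : 0 < 8 / 3 - 1 / ((N + 3) * (N + 2)) * ((N + 4) * (N + 2) + f) := by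
    rw [sub_pos, one_div_mul_eq_div, div_lt_iff₀ hc]
    nlinarith
  have hW := PosUpTo.prod (f := fun i : ℕ => C (2 / (i + 4 : ℚ)) * X + C 1)
    (fun i => PosUpTo.linear (by positivity) one_pos) N
  have hV := PosUpTo.prod (f := fun i : ℕ => C (1 / (i + 2 : ℚ)) * X + C 1)
    (fun i => PosUpTo.linear (by positivity) one_pos) N
  have hWV : NonnegCoeffs (∏ i ∈ Finset.range N, (C (2 / (i + 4 : ℚ)) * X + C 1) -
      ∏ i ∈ Finset.range N, (C (1 / (i + 2 : ℚ)) * X + C 1)) := by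
    refine NonnegCoeffs.prod_sub_prod
      (fun i => (PosUpTo.linear (by positivity) one_pos).nonneg)
      (fun i => (PosUpTo.linear (by positivity) one_pos).nonneg) (fun i => ?_) N
    rw [add_sub_add_right_eq_sub, ← sub_mul, ← C_sub]
    refine (NonnegCoeffs.C ?_).mul NonnegCoeffs.X
    rw [sub_nonneg, div_le_div_iff₀ (by positivity) (by positivity)]
    have : (0 : ℚ) ≤ i := Nat.cast_nonneg i
    linarith
  have hL : PosUpTo 1 (C (N + 4 + f * (N + 2)) * X + C ((N + 4) * (N + 2) + f)) :=
    PosUpTo.linear (by positivity) (by positivity)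
  have key := (PosUpTo.linear one_pos one_pos).mul
    (((PosUpTo.quadratic hA hB one_pos).mul hW).add
      (((NonnegCoeffs.C (one_div_pos.2 hc).le).mul NonnegCoeffs.X).mul hL.nonneg |>.mul hWV)
      ?_)
  · rwa [show 1 + (2 + N) = N + 4 - 1 by omega] at key
  · refine natDegree_mul_le_of_le (natDegree_mul_le_of_le ?_ hL.1)
      ((natDegree_sub_le _ _).trans (max_le hW.1 hV.1))
    exact (natDegree_C_mul_le _ _).trans natDegree_X_le

theorem posUpTo_ehrUniform_sub_four :
    PosUpTo 2 (ehrUniform 4 - C ((4 / 2 : ℕ) : ℚ) * ehrMinimalShift 4) := by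
  have : ehrUniform 4 - C ((4 / 2 : ℕ) : ℚ) * ehrMinimalShift 4 =
      C 1 * X ^ 2 + C 2 * X + C 1 := by
    simp only [ehrUniform, ehrMinimalShift, Finset.prod_range_succ, Finset.prod_range_zero]
    refine Polynomial.funext fun x => ?_
    simp [Nat.factorial]
    ring
  rw [this]
  exact PosUpTo.quadratic one_pos two_pos one_pos

/-- For n = 3 and n = 4 the leading terms cancel and the degree is n - 2, so `d` cannot be fixed as
n - 1. -/
theorem exists_posUpTo_ehrUniform_sub {n : ℕ} (hn : 3 ≤ n) :
    ∃ d ≤ n - 1, PosUpTo d (ehrUniform n - C ((n / 2 : ℕ) : ℚ) * ehrMinimalShift n) := by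
  rcases (by omega : n = 3 ∨ n = 4 ∨ 5 ≤ n) with rfl | rfl | h
  · exact ⟨1, by norm_num, ehrUniform_sub_three ▸ PosUpTo.linear one_pos one_pos⟩
  · exact ⟨2, by norm_num, posUpTo_ehrUniform_sub_four⟩
  · exact ⟨_, le_rfl, posUpTo_ehrUniform_sub h⟩

/-- The factor `i = 0` of the product is X. The constant coefficient vanishes but the others up to
degree n - 1 are positive, as `PosUpTo.add_X_mul` requires. -/
theorem ehrMinimalShift_eq_X_mul {n : ℕ} (hn : 3 ≤ n) :
    ∃ q : ℚ[X], PosUpTo (n - 2) q ∧ ehrMinimalShift n = X * q := by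
  obtain ⟨N, rfl⟩ : ∃ N, n = N + 3 := ⟨n - 3, by omega⟩
  refine ⟨C (((N + 2).factorial : ℚ)⁻¹) * ((∏ i ∈ Finset.range N, (C 1 * X + C (i + 1 : ℚ))) *
    (C ((N + 1 : ℕ) : ℚ) * X + C 1)), ?_, ?_⟩
  · refine PosUpTo.C_mul (by positivity) ((PosUpTo.prod (fun i => ?_) N).mul ?_)
    · exact PosUpTo.linear one_pos (by positivity)
    · exact PosUpTo.linear (by positivity) one_pos
  · rw [ehrMinimalShift, show N + 3 - 2 = N + 1 from rfl, show N + 3 - 1 = N + 2 from rfl,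
      Finset.prod_range_succ']
    simp only [Nat.cast_zero, C_0, add_zero, C_1, one_mul, Nat.cast_add, Nat.cast_one]
    ring

theorem hasPositiveCoeffs_ehrUniform_sub {n m : ℕ} (hn : 3 ≤ n) (hm : m ≤ n / 2) :
    HasPositiveCoeffs (ehrUniform n - C (m : ℚ) * ehrMinimalShift n) := by
  obtain ⟨d, hd, hP⟩ := exists_posUpTo_ehrUniform_sub hn
  rcases hm.eq_or_lt with rfl | hm
  · exact hP.hasPositiveCoeffs
  · obtain ⟨q, hq, hXq⟩ := ehrMinimalShift_eq_X_mul hn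
    have hpos : (0 : ℚ) < (n / 2 : ℕ) - m := sub_pos.2 (Nat.cast_lt.2 hm)
    have := (hP.add_X_mul (hq.C_mul hpos) (by omega)).hasPositiveCoeffs
    convert this using 1
    rw [hXq, C_sub]
    ring

theorem hasPositiveCoeffs_ehrUniform_two : HasPositiveCoeffs (ehrUniform 2) := by
  have : ehrUniform 2 = C 1 := by
    simp only [ehrUniform, Finset.prod_range_succ, Finset.prod_range_zero]
    refine Polynomial.funext fun x => ?_
    simp
  rw [this]
  intro i hi
  rw [natDegree_C, Nat.le_zero] at hi
  simp [hi]

theorem eval_ehrUniform {n : ℕ} (hn : 2 ≤ n) (t : ℕ) :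
    (ehrUniform n).eval (t : ℚ) =
      ((2 * t + n - 1).choose (n - 1) : ℚ) - n * ((t + n - 2).choose (n - 1) : ℚ) := by
  obtain ⟨N, rfl⟩ : ∃ N, n = N + 2 := ⟨n - 2, by omega⟩
  have h1 := Nat.ascFactorial_eq_factorial_mul_choose (2 * t) (N + 1)
  have h2 := Nat.ascFactorial_eq_factorial_mul_choose' t (N + 1)
  rw [Nat.ascFactorial_eq_prod_range] at h1 h2
  have hne : ((N + 1).factorial : ℚ) ≠ 0 := by positivity
  rw [ehrUniform, show N + 2 - 1 = N + 1 from rfl,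
    show 2 * t + (N + 2) - 1 = 2 * t + (N + 1) by omega,
    show t + (N + 2) - 2 = t + (N + 1) - 1 by omega]
  have e1 : (∏ i ∈ Finset.range (N + 1), (C 2 * X + C (i + 1 : ℚ))).eval (t : ℚ) =
      (N + 1).factorial * ((2 * t + (N + 1)).choose (N + 1) : ℚ) := by
    rw [eval_prod, ← Nat.cast_mul, ← h1, Nat.cast_prod]
    refine Finset.prod_congr rfl fun i _ => ?_
    simp
    ring
  have e2 : (∏ i ∈ Finset.range (N + 1), (X + C (i : ℚ))).eval (t : ℚ) =
      (N + 1).factorial * ((t + (N + 1) - 1).choose (N + 1) : ℚ) := by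
    rw [eval_prod, ← Nat.cast_mul, ← h2, Nat.cast_prod]
    refine Finset.prod_congr rfl fun i _ => ?_
    simp
  rw [eval_mul, eval_sub, eval_mul, e1, e2, eval_C, eval_C]
  field_simp

theorem eval_ehrMinimalShift_succ {n : ℕ} (hn : 3 ≤ n) (t : ℕ) :
    (ehrMinimalShift n).eval ((t + 1 : ℕ) : ℚ) =
      ((∑ s ∈ Finset.range (t + 1), (n - 2 + s - 1).choose s * (s + 1) : ℕ) : ℚ) := by
  obtain ⟨N, rfl⟩ : ∃ N, n = N + 3 := ⟨n - 3, by omega⟩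
  have hev : ∀ x : ℚ, (ehrMinimalShift (N + 3)).eval x = ((N + 2).factorial : ℚ)⁻¹ *
      ((∏ i ∈ Finset.range (N + 1), (x + i)) * ((N + 1) * x + 1)) := by
    intro x
    rw [ehrMinimalShift, show N + 3 - 2 = N + 1 from rfl, show N + 3 - 1 = N + 2 from rfl]
    simp only [eval_mul, eval_add, eval_C, eval_X, eval_prod]
    push_cast
    ring
  have hne : (N.factorial : ℚ) ≠ 0 := by positivity
  rw [hev]
  induction t with
  | zero =>
    have h : ∏ i ∈ Finset.range (N + 1), (((0 + 1 : ℕ) : ℚ) + i) = (N + 1).factorial := by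
      rw [← Finset.prod_range_add_one_eq_factorial, Nat.cast_prod]
      refine Finset.prod_congr rfl fun i _ => ?_
      push_cast
      ring
    rw [h, Nat.factorial_succ (N + 1), Nat.factorial_succ N]
    simp only [zero_add, Finset.range_one, Finset.sum_singleton, Nat.choose_zero_right]
    push_cast
    field_simp
  | succ t ih =>
    -- The old value, the new value and the new summand are all written through the product of the t
    -- + 2 + i, leaving a rational identity.
    have hS : ∏ i ∈ Finset.range N, (((t + 1 + 1 : ℕ) : ℚ) + i) =
        N.factorial * ((N + 1 + (t + 1) - 1).choose (t + 1) : ℚ) := by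
      rw [show N + 1 + (t + 1) - 1 = t + 1 + N by omega, Nat.choose_symm_add, ← Nat.cast_mul,
        ← Nat.ascFactorial_eq_factorial_mul_choose, Nat.ascFactorial_eq_prod_range, Nat.cast_prod]
      exact Finset.prod_congr rfl fun i _ => by push_cast; ring
    have hA : ∏ i ∈ Finset.range (N + 1), (((t + 1 : ℕ) : ℚ) + i) =
        (∏ i ∈ Finset.range N, (((t + 1 + 1 : ℕ) : ℚ) + i)) * (t + 1) := by
      rw [Finset.prod_range_succ']
      congr 1
      · exact Finset.prod_congr rfl fun i _ => by push_cast; ring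
      · simp
    rw [show N + 3 - 2 = N + 1 from rfl] at ih ⊢
    rw [Finset.sum_range_succ _ (t + 1), Nat.cast_add (∑ s ∈ _, _), ← ih, hA,
      Finset.prod_range_succ, hS, Nat.factorial_succ (N + 1), Nat.factorial_succ N]
    push_cast
    field_simp
    ring

end Positivity

/-! ### Lattice points of the dilated polytope of a colouring. -/

section Polytope

variable {ι κ : Type*} [Fintype ι] [DecidableEq ι] [DecidableEq κ]

open Classical in
/-- The lattice points of the `t`-th dilation of the basis polytope of the rank-two matroid whose
parallel classes are the fibres of `c`. -/
noncomputable def rankTwoPoints (c : ι → κ) (t : ℕ) : Finset (ι → ℕ) :=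
  {z ∈ Finset.piAntidiag Finset.univ (2 * t) | ∀ k, ∑ i with c i = k, z i ≤ t}

theorem mem_rankTwoPoints {c : ι → κ} {t : ℕ} {z : ι → ℕ} :
    z ∈ rankTwoPoints c t ↔ ∑ i, z i = 2 * t ∧ ∀ k, ∑ i with c i = k, z i ≤ t := by
  simp [rankTwoPoints]

/-- The convex hull of the indicator vectors of the pairs of elements of different colours. -/
def pairPolytope (c : ι → κ) : Set (ι → ℝ) :=
  convexHull ℝ {x | ∃ i j, c i ≠ c j ∧ x = Pi.single i 1 + Pi.single j 1}

/-- Real points need only this inclusion; the converse is used only at lattice points, where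
`exists_pair_sub_mem_rankTwoPoints` supplies it. -/
theorem sum_eq_two_of_mem_pairPolytope {c : ι → κ} {x : ι → ℝ} (hx : x ∈ pairPolytope c) :
    (∀ i, 0 ≤ x i) ∧ ∑ i, x i = 2 ∧ ∀ k, ∑ i with c i = k, x i ≤ 1 := by
  have hsum : ∀ k, IsLinearMap ℝ (fun x : ι → ℝ => ∑ i with c i = k, x i) := fun k =>
    ⟨fun x y => by simp [Finset.sum_add_distrib], fun a x => by simp [Finset.mul_sum]⟩
  have htot : IsLinearMap ℝ (fun x : ι → ℝ => ∑ i, x i) :=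
    ⟨fun x y => by simp [Finset.sum_add_distrib], fun a x => by simp [Finset.mul_sum]⟩
  have hcoord : ∀ i, IsLinearMap ℝ (fun x : ι → ℝ => x i) := fun i =>
    ⟨fun x y => by simp, fun a x => by simp⟩
  have hconv : Convex ℝ {x : ι → ℝ |
      (∀ i, 0 ≤ x i) ∧ ∑ i, x i = 2 ∧ ∀ k, ∑ i with c i = k, x i ≤ 1} := by
    have h1 : Convex ℝ (⋂ i, {x : ι → ℝ | 0 ≤ x i}) :=
      convex_iInter fun i => convex_halfSpace_ge (hcoord i) 0
    have h2 : Convex ℝ (⋂ k, {x : ι → ℝ | ∑ i with c i = k, x i ≤ 1}) :=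
      convex_iInter fun k => convex_halfSpace_le (hsum k) 1
    convert h1.inter ((convex_hyperplane htot 2).inter h2) using 1
    ext x
    simp
  refine convexHull_min ?_ hconv hx
  rintro _ ⟨i, j, hij, rfl⟩
  refine ⟨fun l => ?_, ?_, fun k => ?_⟩
  · have h : ∀ a : ι, 0 ≤ (Pi.single a 1 : ι → ℝ) l := fun a => by
      rw [Pi.single_apply]
      split_ifs <;> norm_num
    exact add_nonneg (h i) (h j)
  · simp [Finset.sum_add_distrib]
    norm_num
  · simp only [Pi.add_apply, Finset.sum_add_distrib, Finset.sum_pi_single', Finset.mem_filter,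
      Finset.mem_univ, true_and]
    split_ifs with h1 h2 <;> first | exact absurd (h1.trans h2.symm) hij | norm_num

/-- Greedy integer decomposition: subtract one unit from each of the two heaviest colours. -/
theorem exists_pair_sub_mem_rankTwoPoints {c : ι → κ} {t : ℕ} {z : ι → ℕ}
    (hz : z ∈ rankTwoPoints c (t + 1)) :
    ∃ i j, c i ≠ c j ∧ ∃ w ∈ rankTwoPoints c t, z = w + (Pi.single i 1 + Pi.single j 1) := by
  rw [mem_rankTwoPoints] at hz
  obtain ⟨htot, hcl⟩ := hz
  set S : κ → ℕ := fun k => ∑ i with c i = k, z i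
  have hsplit : ∀ k, S k + ∑ i with c i ≠ k, z i = 2 * (t + 1) := fun k => by
    rw [← htot]
    exact Finset.sum_filter_add_sum_filter_not _ _ _
  obtain ⟨i, hi, himax⟩ := Finset.exists_max_image ({i | 0 < z i} : Finset ι) (fun i => S (c i)) (by
    obtain ⟨i, -, hi⟩ := Finset.exists_ne_zero_of_sum_ne_zero (by omega : ∑ i, z i ≠ 0)
    exact ⟨i, by simpa [Nat.pos_iff_ne_zero] using hi⟩)
  obtain ⟨j, hj, hjmax⟩ := Finset.exists_max_image ({j | c j ≠ c i ∧ 0 < z j} : Finset ι)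
    (fun i => S (c i)) (by
      have h1 := hsplit (c i)
      have h2 := hcl (c i)
      obtain ⟨j, hj, hj'⟩ := Finset.exists_ne_zero_of_sum_ne_zero
        (by simp only [S] at h1; omega : ∑ j with c j ≠ c i, z j ≠ 0)
      exact ⟨j, by simpa [Nat.pos_iff_ne_zero] using ⟨(Finset.mem_filter.1 hj).2, hj'⟩⟩)
  simp only [Finset.mem_filter, Finset.mem_univ, true_and] at hi hj himax hjmax
  have hij : i ≠ j := fun h => hj.1 (h ▸ rfl)
  have hzeq : z = (z - (Pi.single i 1 + Pi.single j 1)) + (Pi.single i 1 + Pi.single j 1) := by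
    funext l
    simp only [Pi.add_apply, Pi.sub_apply, Pi.single_apply]
    split_ifs with h1 h2 <;> subst_vars <;> first | exact absurd rfl hij | omega
  refine ⟨i, j, hj.1.symm, _, ?_, hzeq⟩
  generalize z - (Pi.single i 1 + Pi.single j 1) = w at hzeq
  rw [mem_rankTwoPoints]
  have hS : ∀ k, S k = ∑ l with c l = k, w l + ((if c i = k then 1 else 0) +
      if c j = k then 1 else 0) := by
    intro k
    simp only [S, hzeq, Pi.add_apply, Finset.sum_add_distrib, Finset.sum_pi_single',
      Finset.mem_filter, Finset.mem_univ, true_and]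
  refine ⟨?_, fun k => ?_⟩
  · rw [hzeq] at htot
    simp [Finset.sum_add_distrib] at htot
    omega
  · have hk := hS k
    have hle : S k ≤ t + 1 := hcl k
    by_cases h1 : c i = k
    · rw [if_pos h1] at hk; omega
    by_cases h2 : c j = k
    · rw [if_pos h2] at hk; omega
    -- A third colour of sum above t would force the two heaviest to be above t as well, giving a
    -- total of at least 3(t+1) > 2(t+1).
    by_contra hlt
    have hpos : ∑ l with c l = k, z l ≠ 0 := by
      change S k ≠ 0
      omega
    obtain ⟨l, hl, hl'⟩ := Finset.exists_ne_zero_of_sum_ne_zero hpos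
    have hlk : c l = k := (Finset.mem_filter.1 hl).2
    have hi' := himax l (Nat.pos_of_ne_zero hl')
    have hj' := hjmax l ⟨fun h => h1 (h ▸ hlk), Nat.pos_of_ne_zero hl'⟩
    rw [hlk] at hi' hj'
    have h3 : S (c i) + S (c j) + S k ≤ ∑ i, z i := by
      simp only [S]
      rw [← Finset.sum_union, ← Finset.sum_union]
      · exact Finset.sum_le_sum_of_subset (Finset.subset_univ _)
      · rw [Finset.disjoint_left]
        simp only [Finset.mem_union, Finset.mem_filter, Finset.mem_univ, true_and]
        rintro a (h | h) h'
        · exact h1 (h.symm.trans h')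
        · exact h2 (h.symm.trans h')
      · rw [Finset.disjoint_left]
        simp only [Finset.mem_filter, Finset.mem_univ, true_and]
        exact fun a h h' => hj.1 (h'.symm.trans h)
    omega

theorem mem_smul_pairPolytope_of_mem_rankTwoPoints {c : ι → κ} (hc : ∃ i j, c i ≠ c j) {t : ℕ}
    {z : ι → ℕ} (hz : z ∈ rankTwoPoints c t) :
    (fun i => (z i : ℝ)) ∈ (t : ℝ) • pairPolytope c := by
  induction t generalizing z with
  | zero =>
    -- The dilate by 0 is {0} only if the polytope is nonempty, which `hc` ensures.
    obtain ⟨i, j, hij⟩ := hc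
    have hne : (pairPolytope c).Nonempty := ⟨_, subset_convexHull ℝ _ ⟨i, j, hij, rfl⟩⟩
    have h0 : ∀ i, z i = 0 := by simpa [mem_rankTwoPoints] using (mem_rankTwoPoints.1 hz).1
    rw [Nat.cast_zero, Set.zero_smul_set hne]
    simp only [h0, Nat.cast_zero]
    rfl
  | succ t ih =>
    obtain ⟨i, j, hij, w, hw, rfl⟩ := exists_pair_sub_mem_rankTwoPoints hz
    have hconv : Convex ℝ (pairPolytope c) := convex_convexHull ℝ _
    rw [Nat.cast_add, Nat.cast_one, hconv.add_smul (Nat.cast_nonneg t) zero_le_one, one_smul]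
    refine Set.mem_add.2 ⟨_, ih hw, Pi.single i 1 + Pi.single j 1,
      subset_convexHull ℝ _ ⟨i, j, hij, rfl⟩, ?_⟩
    funext l
    simp [Pi.single_apply]

theorem ncard_smul_pairPolytope {c : ι → κ} (hc : ∃ i j, c i ≠ c j) (t : ℕ) :
    {z : ι → ℤ | (fun i => (z i : ℝ)) ∈ (t : ℝ) • pairPolytope c}.ncard =
      (rankTwoPoints c t).card := by
  rw [← Set.ncard_coe_finset]
  have hinj : Function.Injective (fun (z : ι → ℕ) (i : ι) => (z i : ℤ)) := fun z w h => by
    funext i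
    exact Int.ofNat_inj.1 (congrFun h i)
  rw [← Set.ncard_image_of_injective _ hinj]
  congr 1
  ext z
  simp only [Set.mem_ofPred_eq, Set.mem_image, Finset.mem_coe]
  constructor
  · rintro ⟨x, hx, hxz⟩
    obtain ⟨h0, h2, h1⟩ := sum_eq_two_of_mem_pairPolytope hx
    have hxz' : ∀ i, (t : ℝ) * x i = z i := fun i => congrFun hxz i
    have hz : ∀ i, 0 ≤ z i := fun i => by
      have := mul_nonneg (Nat.cast_nonneg (α := ℝ) t) (h0 i)
      rw [hxz'] at this
      exact_mod_cast this
    lift z to ι → ℕ using hz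
    refine ⟨z, mem_rankTwoPoints.2 ⟨?_, fun k => ?_⟩, rfl⟩
    · have : (∑ i, (z i : ℝ)) = 2 * t := by
        rw [← h2, Finset.sum_mul]
        exact Finset.sum_congr rfl fun i _ => by rw [mul_comm, hxz']; simp
      exact_mod_cast this
    · have : (∑ i with c i = k, (z i : ℝ)) ≤ t := by
        calc (∑ i with c i = k, (z i : ℝ)) = t * ∑ i with c i = k, x i := by
              rw [Finset.mul_sum]
              exact Finset.sum_congr rfl fun i _ => by rw [hxz']; simp
          _ ≤ t * 1 := mul_le_mul_of_nonneg_left (h1 k) (Nat.cast_nonneg t)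
          _ = t := mul_one _
      exact_mod_cast this
  · rintro ⟨w, hw, rfl⟩
    simpa using mem_smul_pairPolytope_of_mem_rankTwoPoints hc hw

end Polytope

/-! ### Counting the lattice points. -/

section Counting

variable {ι κ : Type*} [Fintype ι] [DecidableEq ι] [DecidableEq κ]

theorem card_piAntidiag_nat (s : Finset ι) (m : ℕ) :
    (Finset.piAntidiag s m).card = (s.card + m - 1).choose m := by
  rw [← Finset.card_finsuppAntidiag_nat_eq_choose]
  refine (Finset.card_bij (fun (f : ι →₀ ℕ) _ => (f : ι → ℕ)) ?_ ?_ ?_).symm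
  · intro f hf
    rw [Finset.mem_finsuppAntidiag] at hf
    rw [Finset.mem_piAntidiag]
    exact ⟨hf.1, fun i hi => hf.2 (Finsupp.mem_support_iff.2 hi)⟩
  · intro f _ g _ h
    exact DFunLike.coe_injective h
  · intro f hf
    rw [Finset.mem_piAntidiag] at hf
    refine ⟨Finsupp.equivFunOnFinite.symm f, ?_, rfl⟩
    rw [Finset.mem_finsuppAntidiag]
    exact ⟨hf.1, fun i hi => hf.2 i (by simpa using hi)⟩

/-- Since two colour classes cannot both have sum above half of the total, the vectors of `X`
are counted by the class, if any, whose sum exceeds `t`. -/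
theorem card_eq_card_filter_add_sum (c : ι → κ) (K : Finset κ) {t : ℕ} {X : Finset (ι → ℕ)}
    (hX : ∀ z ∈ X, ∑ i, z i = 2 * t) :
    X.card = {z ∈ X | ∀ k ∈ K, ∑ i with c i = k, z i ≤ t}.card +
      ∑ k ∈ K, {z ∈ X | t < ∑ i with c i = k, z i}.card := by
  have hbad : {z ∈ X | ¬ ∀ k ∈ K, ∑ i with c i = k, z i ≤ t} =
      K.biUnion fun k => {z ∈ X | t < ∑ i with c i = k, z i} := by
    ext z
    simp only [Finset.mem_filter, Finset.mem_biUnion]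
    push Not
    tauto
  rw [← Finset.card_filter_add_card_filter_not (fun z => ∀ k ∈ K, ∑ i with c i = k, z i ≤ t),
    hbad, Finset.card_biUnion]
  intro k _ l _ hkl
  refine Finset.disjoint_left.2 fun z hk hl => ?_
  rw [Finset.mem_filter] at hk hl
  have h : ∑ i with c i = k, z i + ∑ i with c i = l, z i ≤ ∑ i, z i := by
    rw [← Finset.sum_union]
    · exact Finset.sum_le_sum_of_subset (Finset.subset_univ _)
    · rw [Finset.disjoint_left]
      simp only [Finset.mem_filter, Finset.mem_univ, true_and]
      exact fun i h h' => hkl (h.symm.trans h')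
  have := hX z hk.1
  omega

theorem mem_rankTwoPoints_of_injective {c : ι → κ} (hc : Function.Injective c) {t : ℕ}
    {z : ι → ℕ} : z ∈ rankTwoPoints c t ↔ ∑ i, z i = 2 * t ∧ ∀ i, z i ≤ t := by
  have h : ∀ i, ∑ j with c j = c i, z j = z i := fun i => by
    simp [hc.eq_iff, Finset.filter_eq']
  rw [mem_rankTwoPoints]
  refine and_congr_right fun _ => ⟨fun H i => h i ▸ H (c i), fun H k => ?_⟩
  by_cases hk : ∃ i, c i = k
  · obtain ⟨i, rfl⟩ := hk
    exact (h i).le.trans (H i)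
  · push Not at hk
    simp [hk]

/-- Subtracting t + 1 from coordinate i leaves an arbitrary vector of total t - 1; for t = 0 both
sides vanish. -/
theorem card_filter_lt_apply (hn : 2 ≤ Fintype.card ι) (i : ι) (t : ℕ) :
    {z ∈ Finset.piAntidiag (Finset.univ : Finset ι) (2 * t) | t < z i}.card =
      (t + Fintype.card ι - 2).choose (Fintype.card ι - 1) := by
  cases t with
  | zero =>
    rw [Nat.choose_eq_zero_of_lt
      (show 0 + Fintype.card ι - 2 < Fintype.card ι - 1 by omega), Finset.card_eq_zero,
      Finset.filter_eq_empty_iff]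
    intro z hz
    simp only [Finset.mem_piAntidiag, mul_zero, Finset.sum_eq_zero_iff] at hz
    simp [hz.1 i (Finset.mem_univ i)]
  | succ t =>
    have himg : {z ∈ Finset.piAntidiag (Finset.univ : Finset ι) (2 * (t + 1)) | t + 1 < z i} =
        (Finset.piAntidiag Finset.univ t).image (· + Pi.single i (t + 2)) := by
      ext z
      simp only [Finset.mem_filter, Finset.mem_image, Finset.mem_piAntidiag, Finset.mem_univ,
        implies_true, and_true]
      constructor
      · rintro ⟨h1, h2⟩
        have hle : Pi.single i (t + 2) ≤ z := by
          intro j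
          rw [Pi.single_apply]
          split_ifs with h
          · subst h
            exact h2
          · exact Nat.zero_le _
        have hz := tsub_add_cancel_of_le hle
        refine ⟨_, ?_, hz⟩
        generalize z - Pi.single i (t + 2) = w at hz
        subst hz
        change ∑ i, w i = t
        simp only [Pi.add_apply, Finset.sum_add_distrib, Finset.sum_pi_single', Finset.mem_univ,
          if_true] at h1
        omega
      · rintro ⟨w, (h1 : ∑ i, w i = t), rfl⟩
        simp only [Pi.add_apply, Finset.sum_add_distrib, Finset.sum_pi_single', Finset.mem_univ,
          if_true, Pi.single_eq_same]
        omega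
    rw [himg, Finset.card_image_of_injective _ (add_left_injective _), card_piAntidiag_nat,
      Finset.card_univ, show t + 1 + Fintype.card ι - 2 = t + (Fintype.card ι - 1) by omega,
      show Fintype.card ι + t - 1 = t + (Fintype.card ι - 1) by omega, Nat.choose_symm_add]

/-- From all vectors of total 2t remove, for each i, those with z i > t; these families are
disjoint. -/
theorem card_rankTwoPoints_of_injective {c : ι → κ} (hc : Function.Injective c)
    (hn : 2 ≤ Fintype.card ι) (t : ℕ) :
    ((rankTwoPoints c t).card : ℚ) = (ehrUniform (Fintype.card ι)).eval (t : ℚ) := by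
  have h := card_eq_card_filter_add_sum (id : ι → ι) Finset.univ
    (t := t) (X := Finset.piAntidiag Finset.univ (2 * t)) (by simp)
  have h1 : ∀ (z : ι → ℕ) (k : ι), ∑ i with id i = k, z i = z k := fun z k => by
    simp [Finset.filter_eq']
  simp only [h1, card_filter_lt_apply hn, Finset.sum_const, Finset.card_univ, smul_eq_mul,
    card_piAntidiag_nat, Finset.mem_univ, true_imp_iff] at h
  have h2 : {z ∈ Finset.piAntidiag (Finset.univ : Finset ι) (2 * t) | ∀ k, z k ≤ t} =
      rankTwoPoints c t := by
    ext z
    simp [mem_rankTwoPoints_of_injective hc]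
  rw [h2, show Fintype.card ι + 2 * t - 1 = 2 * t + (Fintype.card ι - 1) by omega,
    Nat.choose_symm_add] at h
  rw [eval_ehrUniform hn, show 2 * t + Fintype.card ι - 1 = 2 * t + (Fintype.card ι - 1) by omega,
    h]
  push_cast
  ring

/-- The lattice points of the `t`-th dilation of the basis polytope of the minimal matroid of
rank two, with singleton parallel classes `a` and `b`. -/
def minimalPoints (a b : ι) (t : ℕ) : Finset (ι → ℕ) :=
  {z ∈ Finset.piAntidiag Finset.univ (2 * t) | z a ≤ t ∧ z b ≤ t ∧ t ≤ z a + z b}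

theorem mem_minimalPoints {a b : ι} {t : ℕ} {z : ι → ℕ} :
    z ∈ minimalPoints a b t ↔ ∑ i, z i = 2 * t ∧ z a ≤ t ∧ z b ≤ t ∧ t ≤ z a + z b := by
  simp [minimalPoints]

theorem sum_eq_add_add_sum_compl {a b : ι} (hab : a ≠ b) (z : ι → ℕ) :
    ∑ i, z i = z a + z b + ∑ i ∈ ({a, b} : Finset ι)ᶜ, z i := by
  rw [← Finset.sum_add_sum_compl {a, b}, Finset.sum_pair hab]

/-- Let s be the sum outside {a, b}; it is at most t. The deficits t - z a and t - z b add up to s,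
which leaves s + 1 choices for them. -/
theorem card_minimalPoints {a b : ι} (hab : a ≠ b) (t : ℕ) :
    (minimalPoints a b t).card =
      ∑ s ∈ Finset.range (t + 1), (Fintype.card ι - 2 + s - 1).choose s * (s + 1) := by
  have hcard : (({a, b} : Finset ι)ᶜ).card = Fintype.card ι - 2 := by
    rw [Finset.card_compl, Finset.card_pair hab]
  have hfib : ∀ s ∈ Finset.range (t + 1),
      {z ∈ minimalPoints a b t | ∑ i ∈ ({a, b} : Finset ι)ᶜ, z i = s}.card =
        (Fintype.card ι - 2 + s - 1).choose s * (s + 1) := by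
    intro s hs
    rw [Finset.mem_range] at hs
    rw [← hcard, ← card_piAntidiag_nat, ← Finset.card_range (s + 1), ← Finset.card_product]
    symm
    have hval : ∀ w ∈ Finset.piAntidiag ({a, b} : Finset ι)ᶜ s, w a = 0 ∧ w b = 0 := by
      intro w hw
      rw [Finset.mem_piAntidiag] at hw
      exact ⟨by_contra fun h => by simpa using hw.2 a h, by_contra fun h => by simpa using hw.2 b h⟩
    have hsum : ∀ (w : ι → ℕ) (x y : ℕ), ∑ i ∈ ({a, b} : Finset ι)ᶜ,
        (w + (Pi.single a x + Pi.single b y) : ι → ℕ) i = ∑ i ∈ ({a, b} : Finset ι)ᶜ, w i := by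
      intro w x y
      simp [Finset.sum_add_distrib, Finset.sum_pi_single']
    refine Finset.card_bij (fun wp _ => wp.1 +
      (Pi.single a (t - wp.2) + Pi.single b (t - (s - wp.2)))) ?_ ?_ ?_
    · rintro ⟨w, p⟩ hwp
      obtain ⟨hw, hp⟩ := Finset.mem_product.1 hwp
      obtain ⟨ha, hb⟩ := hval w hw
      simp only [Finset.mem_range, Finset.mem_piAntidiag] at hp hw
      rw [Finset.mem_filter, mem_minimalPoints, sum_eq_add_add_sum_compl hab, hsum, hw.1]
      simp only [Pi.add_apply, Pi.single_eq_same, Pi.single_eq_of_ne hab,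
        Pi.single_eq_of_ne hab.symm, ha, hb, and_true]
      omega
    · rintro ⟨w, p⟩ hwp ⟨w', p'⟩ hwp' h
      obtain ⟨hw, hp⟩ := Finset.mem_product.1 hwp
      obtain ⟨hw', hp'⟩ := Finset.mem_product.1 hwp'
      simp only at h hw hw' hp hp'
      rw [Finset.mem_range] at hp hp'
      have hpp : p = p' := by
        have := congrFun h a
        simp only [Pi.add_apply, Pi.single_eq_same, Pi.single_eq_of_ne hab, (hval w hw).1,
          (hval w' hw').1] at this
        omega
      subst hpp
      rw [add_left_injective _ h]
    · intro z hz
      rw [Finset.mem_filter, mem_minimalPoints, sum_eq_add_add_sum_compl hab] at hz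
      refine ⟨(fun i => if i = a ∨ i = b then 0 else z i, t - z a), ?_, ?_⟩
      · rw [Finset.mem_product, Finset.mem_piAntidiag, Finset.mem_range]
        refine ⟨⟨?_, fun i hi => ?_⟩, by dsimp only; omega⟩
        · rw [← hz.2]
          refine Finset.sum_congr rfl fun i hi => if_neg ?_
          simpa using hi
        · simp only [ne_eq, ite_eq_left_iff, not_forall] at hi
          obtain ⟨hi, -⟩ := hi
          simpa using hi
      · funext i
        by_cases hia : i = a
        · subst hia
          simp only [Pi.add_apply, Pi.single_eq_same, Pi.single_eq_of_ne hab, true_or, if_true]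
          omega
        by_cases hib : i = b
        · subst hib
          simp only [Pi.add_apply, Pi.single_eq_same, Pi.single_eq_of_ne hia, or_true, if_true]
          omega
        simp [hia, hib]
  rw [← Finset.sum_congr rfl hfib]
  refine Finset.card_eq_sum_card_fiberwise fun z hz => ?_
  have hz' := mem_minimalPoints.1 (Finset.mem_coe.1 hz)
  rw [sum_eq_add_add_sum_compl hab] at hz'
  rw [Finset.mem_coe, Finset.mem_range]
  omega

/-- Translation by e_a + e_b. This is the origin of the term ehr(T_{2,n}, t-1). -/
theorem card_rankTwoPoints_filter_lt {c : ι → κ} (hc : Function.Injective c) {a b : ι}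
    (hab : a ≠ b) (hn : 3 ≤ Fintype.card ι) (t : ℕ) :
    ({z ∈ rankTwoPoints c t | t < z a + z b}.card : ℚ) =
      (ehrMinimalShift (Fintype.card ι)).eval (t : ℚ) := by
  cases t with
  | zero =>
    obtain ⟨q, -, hq⟩ := ehrMinimalShift_eq_X_mul hn
    rw [hq, Nat.cast_zero, Polynomial.eval_mul, Polynomial.eval_X, zero_mul, Nat.cast_eq_zero,
      Finset.card_eq_zero, Finset.filter_eq_empty_iff]
    intro z hz
    have := (mem_rankTwoPoints_of_injective hc).1 hz
    have h1 := this.2 a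
    have h2 := this.2 b
    omega
  | succ t =>
    rw [eval_ehrMinimalShift_succ hn, ← card_minimalPoints hab, Nat.cast_inj]
    have himg : {z ∈ rankTwoPoints c (t + 1) | t + 1 < z a + z b} =
        (minimalPoints a b t).image (· + (Pi.single a 1 + Pi.single b 1)) := by
      ext z
      rw [Finset.mem_filter, Finset.mem_image, mem_rankTwoPoints_of_injective hc]
      simp only [mem_minimalPoints]
      constructor
      · rintro ⟨⟨h1, h2⟩, h3⟩
        have ha := h2 a
        have hb := h2 b
        have hle : Pi.single a 1 + Pi.single b 1 ≤ z := by
          intro j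
          simp only [Pi.add_apply, Pi.single_apply]
          split_ifs with h h' <;> subst_vars <;> first | exact absurd rfl hab | omega
        have hz := tsub_add_cancel_of_le hle
        refine ⟨_, ?_, hz⟩
        generalize z - (Pi.single a 1 + Pi.single b 1) = w at hz
        subst hz
        simp only [Pi.add_apply, Finset.sum_add_distrib, Finset.sum_pi_single', Finset.mem_univ,
          if_true, Pi.single_eq_same, Pi.single_eq_of_ne hab,
          Pi.single_eq_of_ne hab.symm] at h1 h3 ha hb
        omega
      · rintro ⟨w, ⟨h1, h2, h3, h4⟩, rfl⟩
        -- The bounds on the other coordinates are automatic: those add up to 2t - (w a + w b) ≤ t.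
        have hle : ∀ i, i ≠ a → i ≠ b → w i ≤ t := fun i hia hib => by
          have := Finset.single_le_sum (f := w) (fun _ _ => Nat.zero_le _)
            (show i ∈ ({a, b} : Finset ι)ᶜ by simp [hia, hib])
          rw [sum_eq_add_add_sum_compl hab] at h1
          omega
        refine ⟨⟨?_, fun i => ?_⟩, ?_⟩
        · simp only [Pi.add_apply, Finset.sum_add_distrib, Finset.sum_pi_single', Finset.mem_univ,
            if_true]
          omega
        · by_cases hia : i = a
          · subst hia
            simpa [Pi.single_eq_of_ne hab] using h2
          by_cases hib : i = b
          · subst hib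
            simpa [Pi.single_eq_of_ne hia] using h3
          simpa [hia, hib] using (hle i hia hib).trans (Nat.le_succ t)
        · simp only [Pi.add_apply, Pi.single_eq_same, Pi.single_eq_of_ne hab,
            Pi.single_eq_of_ne hab.symm]
          omega
    rw [himg, Finset.card_image_of_injective _ (add_left_injective _)]

/-- The colours that occur exactly twice. -/
def doubleColours (c : ι → κ) : Finset κ :=
  {k ∈ Finset.univ.image c | ({i | c i = k} : Finset ι).card = 2}

omit [DecidableEq ι] in
theorem two_mul_card_doubleColours_le (c : ι → κ) :
    2 * (doubleColours c).card ≤ Fintype.card ι := by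
  rw [mul_comm, ← smul_eq_mul, ← Finset.card_univ,
    Finset.card_eq_sum_card_image c Finset.univ]
  refine (Finset.card_nsmul_le_sum (doubleColours c) _ 2 fun k hk => ?_).trans
    (Finset.sum_le_sum_of_subset (Finset.filter_subset _ _))
  exact (Finset.mem_filter.1 hk).2.ge

/-- Singleton colours impose only z i ≤ t, already true for distinct colours, so only the double
colours remove points. -/
theorem card_rankTwoPoints_of_card_fibre_le_two {c : ι → κ}
    (hc : ∀ k, ({i | c i = k} : Finset ι).card ≤ 2) (hn : 3 ≤ Fintype.card ι) (t : ℕ) :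
    ((rankTwoPoints c t).card : ℚ) = (ehrUniform (Fintype.card ι) -
      Polynomial.C ((doubleColours c).card : ℚ) * ehrMinimalShift (Fintype.card ι)).eval
        (t : ℚ) := by
  have hid : Function.Injective (id : ι → ι) := Function.injective_id
  have h := card_eq_card_filter_add_sum c (doubleColours c) (t := t)
    (X := rankTwoPoints (id : ι → ι) t) fun z hz => (mem_rankTwoPoints.1 hz).1
  have h2 : {z ∈ rankTwoPoints (id : ι → ι) t |
      ∀ k ∈ doubleColours c, ∑ i with c i = k, z i ≤ t} = rankTwoPoints c t := by
    ext z
    rw [Finset.mem_filter, mem_rankTwoPoints_of_injective hid, mem_rankTwoPoints, and_assoc]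
    refine and_congr_right fun _ => ⟨fun ⟨h1, h2⟩ k => ?_, fun H => ⟨fun i => ?_, fun k _ => H k⟩⟩
    · rcases Nat.lt_or_ge ({i | c i = k} : Finset ι).card 2 with hk | hk
      · rcases (by omega : ({i | c i = k} : Finset ι).card = 0 ∨
          ({i | c i = k} : Finset ι).card = 1) with hk | hk
        · rw [Finset.card_eq_zero.1 hk, Finset.sum_empty]
          exact Nat.zero_le t
        · obtain ⟨i, hi⟩ := Finset.card_eq_one.1 hk
          rw [hi, Finset.sum_singleton]
          exact h1 i
      · refine h2 k (Finset.mem_filter.2 ⟨?_, le_antisymm (hc k) hk⟩)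
        obtain ⟨i, hi⟩ := Finset.card_pos.1 (by omega : 0 < ({i | c i = k} : Finset ι).card)
        exact Finset.mem_image.2 ⟨i, Finset.mem_univ _, (Finset.mem_filter.1 hi).2⟩
    · exact (Finset.single_le_sum (f := z) (fun _ _ => Nat.zero_le _) (by simp)).trans (H (c i))
  have h3 : ∀ k ∈ doubleColours c,
      (({z ∈ rankTwoPoints (id : ι → ι) t | t < ∑ i with c i = k, z i}.card : ℕ) : ℚ) =
        (ehrMinimalShift (Fintype.card ι)).eval (t : ℚ) := by
    intro k hk
    obtain ⟨a, b, hab, hk'⟩ := Finset.card_eq_two.1 (Finset.mem_filter.1 hk).2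
    rw [hk']
    simp only [Finset.sum_pair hab]
    exact card_rankTwoPoints_filter_lt hid hab hn t
  rw [Polynomial.eval_sub, Polynomial.eval_mul, Polynomial.eval_C,
    ← card_rankTwoPoints_of_injective hid (by omega), h, h2, Nat.cast_add, Nat.cast_sum,
    Finset.sum_congr rfl h3, Finset.sum_const, nsmul_eq_mul, add_sub_cancel_right]

/-- As the total is 2t, the bound t on the third colour is the same as t ≤ z a + z b. -/
theorem card_rankTwoPoints_of_minimal {c : ι → κ} {a b : ι} (hab : c a ≠ c b)
    (ha : ∀ i, i ≠ a → c i ≠ c a) (hb : ∀ i, i ≠ b → c i ≠ c b)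
    (hc : ∀ i j, i ≠ a → i ≠ b → j ≠ a → j ≠ b → c i = c j) (hn : 3 ≤ Fintype.card ι) (t : ℕ) :
    ((rankTwoPoints c t).card : ℚ) =
      ((ehrMinimalShift (Fintype.card ι)).comp (Polynomial.X + 1)).eval (t : ℚ) := by
  have hab' : a ≠ b := fun h => hab (h ▸ rfl)
  have heq : rankTwoPoints c t = minimalPoints a b t := by
    ext z
    rw [mem_rankTwoPoints, mem_minimalPoints]
    refine and_congr_right fun htot => ?_
    rw [sum_eq_add_add_sum_compl hab'] at htot
    have hfa : ({i | c i = c a} : Finset ι) = {a} := by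
      ext i
      simpa using ⟨fun h => by_contra fun h' => ha i h' h, fun h => h ▸ rfl⟩
    have hfb : ({i | c i = c b} : Finset ι) = {b} := by
      ext i
      simpa using ⟨fun h => by_contra fun h' => hb i h' h, fun h => h ▸ rfl⟩
    have hfo : ∀ j, j ≠ a → j ≠ b → ({i | c i = c j} : Finset ι) = {a, b}ᶜ := by
      intro j hja hjb
      ext i
      simp only [Finset.mem_filter, Finset.mem_univ, true_and, Finset.mem_compl,
        Finset.mem_insert, Finset.mem_singleton, not_or]
      refine ⟨fun h => ⟨?_, ?_⟩, fun h => hc i j h.1 h.2 hja hjb⟩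
      · rintro rfl
        exact ha j hja h.symm
      · rintro rfl
        exact hb j hjb h.symm
    constructor
    · intro H
      have h1 := H (c a)
      have h2 := H (c b)
      rw [hfa, Finset.sum_singleton] at h1
      rw [hfb, Finset.sum_singleton] at h2
      obtain ⟨j, hj⟩ := Finset.card_pos.1 (by
        rw [Finset.card_compl, Finset.card_pair hab']; omega : 0 < (({a, b} : Finset ι)ᶜ).card)
      simp only [Finset.mem_compl, Finset.mem_insert, Finset.mem_singleton, not_or] at hj
      have h3 := H (c j)
      rw [hfo j hj.1 hj.2] at h3
      omega
    · rintro ⟨h1, h2, h3⟩ k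
      by_cases hk : ∃ j, c j = k
      · obtain ⟨j, rfl⟩ := hk
        by_cases hja : j = a
        · rwa [hja, hfa, Finset.sum_singleton]
        by_cases hjb : j = b
        · rwa [hjb, hfb, Finset.sum_singleton]
        rw [hfo j hja hjb]
        omega
      · push Not at hk
        simp [hk]
  rw [heq, card_minimalPoints hab', ← eval_ehrMinimalShift_succ hn]
  simp

end Counting

/-! ### Loopless matroids of rank two as colourings by parallel classes. -/

section RankTwo

variable {α κ : Type*} {M : Matroid α}

/-- The parallel class of a nonloop, as the flat it spans. -/
def parallelClass (M : Matroid α) (e : M.E) : Set α :=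
  M.closure {(e : α)}

theorem parallelClass_ne_iff (hl : ∀ e ∈ M.E, M.Indep {e}) (e f : M.E) :
    parallelClass M e ≠ parallelClass M f ↔ (e : α) ≠ f ∧ M.Indep {(e : α), (f : α)} := by
  have key : ∀ x y : M.E, (x : α) ≠ y →
      ((x : α) ∉ M.closure {(y : α)} ↔ M.Indep {(x : α), (y : α)}) := fun x y hxy =>
    (hl y y.2).notMem_closure_iff_of_notMem (by simpa using hxy) x.2
  constructor
  · intro h
    have hne : (e : α) ≠ f := fun h' => h (by rw [parallelClass, parallelClass, h'])
    refine ⟨hne, (key e f hne).1 fun hef => h ?_⟩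
    have hfe : (f : α) ∈ M.closure {(e : α)} := by
      by_contra hfe
      rw [key f e hne.symm, Set.pair_comm, ← key e f hne] at hfe
      exact hfe hef
    exact (M.closure_subset_closure_of_subset_closure (by simpa using hef)).antisymm
      (M.closure_subset_closure_of_subset_closure (by simpa using hfe))
  · rintro ⟨hne, hI⟩ h
    refine (key e f hne).2 hI ?_
    rw [parallelClass, parallelClass] at h
    rw [← h]
    exact M.mem_closure_of_mem rfl (by simp)

theorem isBase_iff_parallelClass_ne (hl : ∀ e ∈ M.E, M.Indep {e}) (hr : M.eRank = 2) (B : Set α) :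
    M.IsBase B ↔ ∃ i j : M.E, parallelClass M i ≠ parallelClass M j ∧ B = {(i : α), (j : α)} := by
  constructor
  · intro hB
    obtain ⟨x, y, hxy, rfl⟩ := Set.encard_eq_two.1 (hB.encard_eq_eRank.trans hr)
    have hx : x ∈ M.E := hB.subset_ground (by simp)
    have hy : y ∈ M.E := hB.subset_ground (by simp)
    exact ⟨⟨x, hx⟩, ⟨y, hy⟩, (parallelClass_ne_iff hl _ _).2 ⟨hxy, hB.indep⟩, rfl⟩
  · rintro ⟨i, j, hij, rfl⟩
    obtain ⟨hne, hI⟩ := (parallelClass_ne_iff hl _ _).1 hij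
    refine hI.isBase_of_eRk_ge (Set.toFinite _) ?_
    rw [hI.eRk_eq_encard, Set.encard_pair hne, hr]

theorem basisPolytope_eq_pairPolytope [DecidableEq M.E] {c : M.E → κ}
    (hB : ∀ B, M.IsBase B ↔ ∃ i j : M.E, c i ≠ c j ∧ B = {(i : α), (j : α)}) :
    basisPolytope M = pairPolytope c := by
  have hind : ∀ i j : M.E, c i ≠ c j →
      Set.indicator {l : M.E | (l : α) ∈ ({(i : α), (j : α)} : Set α)} (fun _ => (1 : ℝ)) =
        Pi.single i 1 + Pi.single j 1 := by
    intro i j hij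
    funext l
    simp only [Set.indicator_apply, Set.mem_ofPred_eq, Set.mem_insert_iff, Set.mem_singleton_iff,
      Subtype.coe_inj, Pi.add_apply, Pi.single_apply]
    split_ifs with h1 h2 h3 <;> subst_vars <;> simp_all
  rw [basisPolytope, pairPolytope]
  congr 1
  ext x
  constructor
  · rintro ⟨B, hBB, rfl⟩
    obtain ⟨i, j, hij, rfl⟩ := (hB B).1 hBB
    exact ⟨i, j, hij, hind i j hij⟩
  · rintro ⟨i, j, hij, rfl⟩
    exact ⟨_, (hB _).2 ⟨i, j, hij, rfl⟩, (hind i j hij).symm⟩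

theorem isEhrhartPolynomial_basisPolytope [Fintype M.E] [DecidableEq M.E] [DecidableEq κ]
    {c : M.E → κ} (hB : ∀ B, M.IsBase B ↔ ∃ i j : M.E, c i ≠ c j ∧ B = {(i : α), (j : α)})
    {p : Polynomial ℚ} (hp : ∀ t : ℕ, ((rankTwoPoints c t).card : ℚ) = p.eval (t : ℚ)) :
    IsEhrhartPolynomial (basisPolytope M) p := by
  intro t
  have hc : ∃ i j, c i ≠ c j := by
    obtain ⟨B, hBB⟩ := M.exists_isBase
    obtain ⟨i, j, hij, -⟩ := (hB B).1 hBB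
    exact ⟨i, j, hij⟩
  rw [basisPolytope_eq_pairPolytope hB, ncard_smul_pairPolytope hc, hp]

theorem isEhrhartPolynomial_uniformMatroid {n : ℕ} (hn : 2 ≤ n) :
    IsEhrhartPolynomial (basisPolytope (uniformMatroid 2 n hn)) (ehrUniform n) := by
  classical
  have hE : (uniformMatroid 2 n hn).E = Set.univ := rfl
  have : Fintype (uniformMatroid 2 n hn).E := Fintype.ofFinite _
  have hcard : Fintype.card (uniformMatroid 2 n hn).E = n := by
    rw [← Nat.card_eq_fintype_card, Nat.card_coe_set_eq, hE, Set.ncard_univ, Nat.card_fin]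
  refine isEhrhartPolynomial_basisPolytope (c := fun e => (e : Fin n)) (fun B => ?_) fun t => ?_
  · have h2 : (uniformMatroid 2 n hn).IsBase B ↔ B.ncard = 2 := Iff.rfl
    rw [h2, Set.ncard_eq_two]
    exact ⟨fun ⟨x, y, hxy, h⟩ => ⟨⟨x, trivial⟩, ⟨y, trivial⟩, hxy, h⟩,
      fun ⟨x, y, hxy, h⟩ => ⟨x, y, hxy, h⟩⟩
  · rw [card_rankTwoPoints_of_injective Subtype.val_injective (hn.trans_eq hcard.symm), hcard]

end RankTwo

/-! ### Sparse paving matroids of rank two. -/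

section SparsePaving

variable {α : Type*} {M : Matroid α}

theorem IsPaving.indep_singleton (hM : IsPaving M) (hr : M.eRank = 2) {e : α} (he : e ∈ M.E) :
    M.Indep {e} := by
  by_contra h
  have h' := hM {e} (Matroid.singleton_isCircuit.2 ((Matroid.singleton_not_indep he).1 h))
  rw [hr, Set.encard_singleton] at h'
  exact absurd h' (by decide)

/-- A flat of rank at most 1 is not spanning, so its complement contains a circuit of the dual. That
circuit has at least |E| - 2 elements, the rank of the dual. -/
theorem encard_closure_singleton_le_two [M.Finite] (hM : IsPaving M✶) (hr : M.eRank = 2) (e : α) :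
    (M.closure {e}).encard ≤ 2 := by
  have hsub : M.closure {e} ⊆ M.E := M.closure_subset_ground _
  have hns : ¬ M.Spanning (M.closure {e}) := by
    intro h
    have h1 := h.eRk_eq
    rw [M.eRk_closure_eq, hr] at h1
    have h2 := M.eRk_le_encard {e}
    rw [h1, Set.encard_singleton] at h2
    exact absurd h2 (by decide)
  have hdep : M✶.Dep (M.E \ M.closure {e}) := by
    rw [← Matroid.not_indep_iff (by exact Set.sdiff_subset), ← Matroid.coindep_def,
      Matroid.coindep_iff_compl_spanning, Set.sdiff_sdiff_cancel_left hsub]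
    exact hns
  obtain ⟨C, hC, hCirc⟩ := hdep.exists_isCircuit_subset
  have h1 := (hM C hCirc).trans (Set.encard_le_encard hC)
  have h2 := M.eRank_add_eRank_dual
  have h3 := Set.encard_sdiff_add_encard_of_subset hsub
  have hfin : (M.E \ M.closure {e}).encard ≠ ⊤ :=
    Set.encard_ne_top_iff.2 (M.ground_finite.subset Set.sdiff_subset)
  rw [hr] at h2
  refine (ENat.add_le_add_iff_left hfin).1 ?_
  rw [h3, ← h2, add_comm 2]
  exact add_le_add_left h1 2

theorem IsSparsePaving.isEhrhartPositive [M.Finite] (hM : IsSparsePaving M) (hr : M.eRank = 2) :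
    IsEhrhartPositive M := by
  classical
  have : Fintype M.E := Set.Finite.fintype M.ground_finite
  have hl : ∀ e ∈ M.E, M.Indep {e} := fun e he => hM.1.indep_singleton hr he
  have hB := isBase_iff_parallelClass_ne hl hr
  have hfib : ∀ k, ({i | parallelClass M i = k} : Finset M.E).card ≤ 2 := by
    intro k
    by_cases hk : ∃ i, parallelClass M i = k
    · obtain ⟨i, rfl⟩ := hk
      rw [← Finset.card_map (Function.Embedding.subtype _), ← Nat.cast_le (α := ℕ∞),
        ← Set.encard_coe_eq_coe_finsetCard]
      refine (Set.encard_le_encard ?_).trans (encard_closure_singleton_le_two hM.2 hr (i : α))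
      intro x hx
      simp only [Finset.coe_map, Set.mem_image, Finset.mem_coe, Finset.mem_filter,
        Finset.mem_univ, true_and] at hx
      obtain ⟨j, hj, rfl⟩ := hx
      change M.closure _ = M.closure _ at hj
      rw [← hj]
      exact M.mem_closure_of_mem rfl (by simp)
    · push Not at hk
      simp [hk]
  obtain ⟨B, hBB⟩ := M.exists_isBase
  obtain ⟨i, j, hij, -⟩ := (hB B).1 hBB
  have hne : i ≠ j := fun h => hij (h ▸ rfl)
  have hn : 2 ≤ Fintype.card M.E := by
    rw [← Finset.card_pair hne]
    exact Finset.card_le_univ _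
  rcases hn.eq_or_lt with hn2 | hn3
  -- With two elements the polytope is a point and the polynomial is 1; the formula with double
  -- classes needs n ≥ 3.
  · have hinj : Function.Injective (parallelClass M) := by
      have huniv : ({i, j} : Finset M.E) = Finset.univ :=
        Finset.eq_univ_of_card _ (by rw [Finset.card_pair hne, hn2])
      intro x y hxy
      have hx := huniv ▸ Finset.mem_univ x
      have hy := huniv ▸ Finset.mem_univ y
      simp only [Finset.mem_insert, Finset.mem_singleton] at hx hy
      rcases hx with rfl | rfl <;> rcases hy with rfl | rfl
      · rfl
      · exact absurd hxy hij
      · exact absurd hxy.symm hij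
      · rfl
    refine ⟨ehrUniform 2, isEhrhartPolynomial_basisPolytope hB fun t => ?_,
      hasPositiveCoeffs_ehrUniform_two⟩
    rw [card_rankTwoPoints_of_injective hinj hn, ← hn2]
  · refine ⟨_, isEhrhartPolynomial_basisPolytope hB
      (card_rankTwoPoints_of_card_fibre_le_two hfib hn3), hasPositiveCoeffs_ehrUniform_sub hn3 ?_⟩
    have := two_mul_card_doubleColours_le (parallelClass M)
    omega

end SparsePaving

/-! ### Connectedness in rank two, and a connected matroid with few bases. -/

section Connected

variable {α : Type*} {M : Matroid α}

/-- If independence can be tested on A and its complement separately, the matroid is the direct sum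
of its two restrictions. -/
theorem MatroidConnected.eq_empty_or_eq_ground (hM : MatroidConnected M) {A : Set α}
    (hA : A ⊆ M.E)
    (h : ∀ I ⊆ M.E, M.Indep (I ∩ A) → M.Indep (I ∩ (M.E \ A)) → M.Indep I) :
    A = ∅ ∨ M.E \ A = ∅ := by
  have hd : Disjoint (M ↾ A).E (M ↾ (M.E \ A)).E := Set.disjoint_sdiff_right
  refine hM (M ↾ A) (M ↾ (M.E \ A)) hd (Matroid.ext_indep ?_ fun I hI => ?_)
  · rw [Matroid.disjointSum_ground_eq, Matroid.restrict_ground_eq, Matroid.restrict_ground_eq,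
      Set.union_sdiff_cancel hA]
  · simp only [Matroid.disjointSum_indep_iff, Matroid.restrict_ground_eq,
      Matroid.restrict_indep_iff, Set.inter_subset_right, and_true, Set.union_sdiff_cancel hA]
    exact ⟨fun h => ⟨h.subset Set.inter_subset_left, h.subset Set.inter_subset_left, hI⟩,
      fun h' => h I hI h'.1 h'.2.1⟩

theorem MatroidConnected.indep_singleton (hM : MatroidConnected M) (hE : M.E.Nontrivial) {e : α}
    (he : e ∈ M.E) : M.Indep {e} := by
  by_contra hdep
  rcases hM.eq_empty_or_eq_ground (Set.singleton_subset_iff.2 he) fun I hI h1 h2 => by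
    have heI : e ∉ I := fun heI => hdep (by
      rwa [Set.inter_eq_right.2 (Set.singleton_subset_iff.2 heI)] at h1)
    have : I ∩ (M.E \ {e}) = I := by
      rw [Set.inter_eq_left]
      exact fun x hx => ⟨hI hx, fun h => heI (h ▸ hx)⟩
    rwa [this] at h2 with h | h
  · exact Set.singleton_ne_empty e h
  · obtain ⟨f, hf, hfe⟩ := hE.exists_ne e
    exact (h ▸ (⟨hf, hfe⟩ : f ∈ M.E \ {e}) : f ∈ (∅ : Set α))

/-- With only two classes, a set meeting each class independently has at most one element in each,
hence is independent; the matroid would split along the classes. -/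
theorem MatroidConnected.exists_three_parallelClass (hM : MatroidConnected M) (hr : M.eRank = 2)
    (hl : ∀ e ∈ M.E, M.Indep {e}) :
    ∃ i j k : M.E, parallelClass M i ≠ parallelClass M j ∧ parallelClass M i ≠ parallelClass M k ∧
      parallelClass M j ≠ parallelClass M k := by
  obtain ⟨B, hB⟩ := M.exists_isBase
  obtain ⟨i, j, hij, -⟩ := (isBase_iff_parallelClass_ne hl hr B).1 hB
  by_contra! H
  set A : Set α := {x | ∃ hx : x ∈ M.E, parallelClass M ⟨x, hx⟩ = parallelClass M i}
  have hA : A ⊆ M.E := fun x hx => hx.1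
  have hsub : ∀ I S : Set α, I ⊆ M.E → M.Indep (I ∩ S) → (∀ x y : M.E, (x : α) ∈ S → (y : α) ∈ S →
      parallelClass M x = parallelClass M y) → (I ∩ S).Subsingleton := by
    intro I S hI hIS hS x hx y hy
    by_contra hxy
    refine (parallelClass_ne_iff hl ⟨x, hI hx.1⟩ ⟨y, hI hy.1⟩).2
      ⟨hxy, hIS.subset (Set.pair_subset hx hy)⟩ (hS _ _ hx.2 hy.2)
  have hAc : ∀ x : M.E, (x : α) ∈ M.E \ A → parallelClass M x = parallelClass M j := by
    intro x hx
    have hxi : parallelClass M i ≠ parallelClass M x := fun h => hx.2 ⟨x.2, h.symm⟩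
    exact (H i j x hij hxi).symm
  rcases hM.eq_empty_or_eq_ground hA fun I hI h1 h2 => by
    have s1 := hsub I A hI h1 fun x y hx hy => hx.2.trans hy.2.symm
    have s2 := hsub I (M.E \ A) hI h2 fun x y hx hy => (hAc x hx).trans (hAc y hy).symm
    have hIu : I = I ∩ A ∪ I ∩ (M.E \ A) := by
      rw [← Set.inter_union_distrib_left, Set.union_sdiff_cancel hA, Set.inter_eq_left.2 hI]
    rcases s1.eq_empty_or_singleton with e1 | ⟨x, e1⟩
    · rw [e1, Set.empty_union] at hIu
      rwa [hIu]
    rcases s2.eq_empty_or_singleton with e2 | ⟨y, e2⟩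
    · rw [e2, Set.union_empty] at hIu
      rwa [hIu]
    have hx : x ∈ A := (e1 ▸ rfl : x ∈ I ∩ A).2
    have hy : y ∈ M.E \ A := (e2 ▸ rfl : y ∈ I ∩ (M.E \ A)).2
    rw [hIu, e1, e2, Set.singleton_union]
    refine ((parallelClass_ne_iff hl ⟨x, hA hx⟩ ⟨y, hy.1⟩).1 ?_).2
    rw [hx.2, hAc ⟨y, hy.1⟩ hy]
    exact hij with h | h
  · exact (h ▸ (⟨i.2, rfl⟩ : (i : α) ∈ A) : (i : α) ∈ (∅ : Set α))
  · refine (h ▸ (⟨j.2, fun hj => hij hj.2.symm⟩ : (j : α) ∈ M.E \ A) : (j : α) ∈ (∅ : Set α))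

/-- Two of the three elements lie in the same summand. Any element of the other summand, being no
loop, would extend them to an independent triple, against rank 2. -/
theorem matroidConnected_of_three (hr : M.eRank = 2) (hl : ∀ e ∈ M.E, M.Indep {e}) {x y z : α}
    (hxy : x ≠ y) (hxz : x ≠ z) (hyz : y ≠ z) (ixy : M.Indep {x, y}) (ixz : M.Indep {x, z})
    (iyz : M.Indep {y, z}) : MatroidConnected M := by
  have key : ∀ (M₁ M₂ : Matroid α) (h : Disjoint M₁.E M₂.E), M = M₁.disjointSum M₂ h →
      ∀ a b : α, a ≠ b → M.Indep {a, b} → a ∈ M₁.E → b ∈ M₁.E → M₂.E = ∅ := by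
    intro M₁ M₂ h hM a b hab hI ha hb
    by_contra hne
    obtain ⟨g, hg⟩ := Set.nonempty_iff_ne_empty.2 hne
    have hgE : g ∈ M.E := by
      rw [hM, Matroid.disjointSum_ground_eq]
      exact Or.inr hg
    have h1 := hI
    have h2 := hl g hgE
    rw [hM, Matroid.disjointSum_indep_iff] at h1 h2
    have hag : a ≠ g := h.ne_of_mem ha hg
    have hbg : b ≠ g := h.ne_of_mem hb hg
    have hga : g ∉ M₁.E := fun h' => h.ne_of_mem h' hg rfl
    have ha' : a ∉ M₂.E := fun h' => h.ne_of_mem ha h' rfl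
    have hb' : b ∉ M₂.E := fun h' => h.ne_of_mem hb h' rfl
    have h3 : M.Indep {a, b, g} := by
      rw [hM, Matroid.disjointSum_indep_iff]
      refine ⟨h1.1.subset ?_, h2.2.1.subset ?_, ?_⟩
      · rintro u ⟨hu, hu'⟩
        rcases hu with rfl | rfl | rfl
        · exact ⟨by simp, hu'⟩
        · exact ⟨by simp, hu'⟩
        · exact absurd hu' hga
      · rintro u ⟨hu, hu'⟩
        rcases hu with rfl | rfl | rfl
        · exact absurd hu' ha'
        · exact absurd hu' hb'
        · exact ⟨by simp, hu'⟩
      · rintro u (rfl | rfl | rfl)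
        exacts [Or.inl ha, Or.inl hb, Or.inr hg]
    have h4 := h3.encard_le_eRank
    rw [hr, Set.encard_eq_three.2 ⟨a, b, g, hab, hag, hbg, rfl⟩] at h4
    exact absurd h4 (by decide)
  intro M₁ M₂ h hM
  have hM' : M = M₂.disjointSum M₁ h.symm := hM.trans Matroid.disjointSum_comm
  have hmem : ∀ u ∈ M.E, u ∈ M₁.E ∨ u ∈ M₂.E := fun u hu => by
    rwa [hM, Matroid.disjointSum_ground_eq] at hu
  rcases hmem x (ixy.subset_ground (by simp)) with hx | hx <;>
  rcases hmem y (ixy.subset_ground (by simp)) with hy | hy <;>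
  rcases hmem z (ixz.subset_ground (by simp)) with hz | hz
  · exact Or.inr (key _ _ h hM x y hxy ixy hx hy)
  · exact Or.inr (key _ _ h hM x y hxy ixy hx hy)
  · exact Or.inr (key _ _ h hM x z hxz ixz hx hz)
  · exact Or.inl (key _ _ h.symm hM' y z hyz iyz hy hz)
  · exact Or.inr (key _ _ h hM y z hyz iyz hy hz)
  · exact Or.inl (key _ _ h.symm hM' x z hxz ixz hx hz)
  · exact Or.inl (key _ _ h.symm hM' x y hxy ixy hx hy)
  · exact Or.inl (key _ _ h.symm hM' x y hxy ixy hx hy)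

/-- There is a connected matroid of rank two on `n` elements with at most `2n - 3` bases. -/
theorem exists_isConnectedOfRank_two {n : ℕ} (hn : 3 ≤ n) :
    ∃ M : Matroid (Fin n), IsConnectedOfRank 2 n M ∧ {B | M.IsBase B}.ncard ≤ 2 * n - 3 := by
  set p : Fin n := ⟨0, by omega⟩
  set q : Fin n := ⟨1, by omega⟩
  set r : Fin n := ⟨2, by omega⟩
  have hpq : p ≠ q := by simp [p, q, Fin.ext_iff]
  have hpr : p ≠ r := by simp [p, r, Fin.ext_iff]
  have hqr : q ≠ r := by simp [q, r, Fin.ext_iff]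
  set f : Fin n → Fin 3 := fun i => if i = p then 0 else if i = q then 1 else 2
  have hfp : f p = 0 := by simp [f]
  have hfq : f q = 1 := by simp [f, hpq.symm]
  have hfr : f r = 2 := by simp [f, hpr.symm, hqr.symm]
  -- Pulling back U_{2,3} makes the elements of each fibre of `f` parallel: the classes are {p}, {q}
  -- and the rest.
  set M := (uniformMatroid 2 3 (by norm_num)).comap f
  have hind : ∀ I, M.Indep I ↔ (f '' I).ncard ≤ 2 ∧ Set.InjOn f I := fun I => by
    rw [Matroid.comap_indep_iff, uniformMatroid_indep]
  have hpair : ∀ x y, f x ≠ f y → M.Indep {x, y} := by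
    intro x y hxy
    rw [hind, Set.image_pair]
    refine ⟨(Set.ncard_pair hxy).le, ?_⟩
    rw [Set.injOn_pair]
    exact fun h => absurd h hxy
  have ipq : M.Indep {p, q} := hpair _ _ (by rw [hfp, hfq]; decide)
  have hr : M.eRank = 2 := by
    apply le_antisymm
    · obtain ⟨B, hB⟩ := M.exists_isBase
      obtain ⟨h1, h2⟩ := (hind B).1 hB.indep
      rw [← hB.encard_eq_eRank, ← h2.encard_image, ← (Set.toFinite _).cast_ncard_eq]
      exact_mod_cast h1
    · rw [← Set.encard_pair hpq]
      exact ipq.encard_le_eRank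
  have hl : ∀ e ∈ M.E, M.Indep {e} := by
    intro e _
    rw [hind, Set.image_singleton, Set.ncard_singleton]
    exact ⟨by norm_num, Set.injOn_singleton _ _⟩
  refine ⟨M, ⟨rfl, hr, matroidConnected_of_three hr hl hpq hpr hqr ipq
    (hpair _ _ (by rw [hfp, hfr]; decide)) (hpair _ _ (by rw [hfq, hfr]; decide))⟩, ?_⟩
  -- Every base contains p or q: at most n - 1 contain p, and n - 2 contain q but not p.
  have hsub : {B | M.IsBase B} ⊆ (fun j => ({p, j} : Set (Fin n))) '' {p}ᶜ ∪
      (fun j => ({q, j} : Set (Fin n))) '' {p, q}ᶜ := by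
    intro B hB
    have hB : M.IsBase B := hB
    have hinj := ((hind B).1 hB.indep).2
    obtain ⟨x, y, hxy, rfl⟩ := Set.encard_eq_two.1 (hB.encard_eq_eRank.trans hr)
    have hfxy : f x ≠ f y := fun h => hxy (hinj (by simp) (by simp) h)
    by_cases hxp : x = p
    · exact Or.inl ⟨y, fun h => hxy (hxp.trans h.symm), by rw [hxp]⟩
    by_cases hyp : y = p
    · exact Or.inl ⟨x, hxp, by rw [hyp, Set.pair_comm]⟩
    by_cases hxq : x = q
    · exact Or.inr ⟨y, by simpa [hyp] using fun h => hxy (hxq.trans h.symm), by rw [hxq]⟩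
    by_cases hyq : y = q
    · exact Or.inr ⟨x, by simp [hxp, hxq], by rw [hyq, Set.pair_comm]⟩
    exact absurd (by simp [f, hxp, hyp, hxq, hyq]) hfxy
  have h1 : ({p}ᶜ : Set (Fin n)).ncard = n - 1 := by
    rw [Set.ncard_compl, Set.ncard_singleton, Nat.card_fin]
  have h2 : ({p, q}ᶜ : Set (Fin n)).ncard = n - 2 := by
    rw [Set.ncard_compl, Set.ncard_pair hpq, Nat.card_fin]
  refine (Set.ncard_le_ncard hsub (Set.toFinite _)).trans ((Set.ncard_union_le _ _).trans ?_)
  have h3 := Set.ncard_image_le (f := fun j => ({p, j} : Set (Fin n))) (Set.toFinite {p}ᶜ)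
  have h4 := Set.ncard_image_le (f := fun j => ({q, j} : Set (Fin n))) (Set.toFinite {p, q}ᶜ)
  omega

end Connected

/-! ### The parallel classes of a minimal matroid of rank two. -/

section Minimal

theorem two_mul_ncard_isBase {α κ : Type*} {M : Matroid α} [Fintype M.E] [DecidableEq κ]
    {c : M.E → κ} (hB : ∀ B, M.IsBase B ↔ ∃ i j : M.E, c i ≠ c j ∧ B = {(i : α), (j : α)}) :
    2 * {B | M.IsBase B}.ncard = ({x | c x.1 ≠ c x.2} : Finset (M.E × M.E)).card := by
  classical
  set P : Finset (M.E × M.E) := {x | c x.1 ≠ c x.2}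
  set g : M.E × M.E → Set α := fun x => {(x.1 : α), (x.2 : α)}
  have hset : {B | M.IsBase B} = (P.image g : Set (Set α)) := by
    ext B
    simp [hB, P, g, eq_comm]
  rw [hset, Set.ncard_coe_finset, Finset.card_eq_sum_card_image g P, mul_comm, ← smul_eq_mul]
  refine (Finset.sum_const_nat (m := 2) fun B hBB => ?_).symm
  obtain ⟨⟨i, j⟩, hij, rfl⟩ := Finset.mem_image.1 hBB
  have hij : c i ≠ c j := (Finset.mem_filter.1 hij).2
  have hne : i ≠ j := fun h => hij (h ▸ rfl)
  rw [Finset.card_eq_two]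
  refine ⟨(i, j), (j, i), fun h => hne (Prod.ext_iff.1 h).1, ?_⟩
  ext ⟨x, y⟩
  simp only [P, g, Finset.mem_filter, Finset.mem_univ, true_and, Finset.mem_insert,
    Finset.mem_singleton, Prod.mk.injEq, Set.pair_eq_pair_iff, Subtype.coe_inj]
  constructor
  · exact fun h => h.2
  · rintro (⟨rfl, rfl⟩ | ⟨rfl, rfl⟩)
    · exact ⟨hij, Or.inl ⟨rfl, rfl⟩⟩
    · exact ⟨hij.symm, Or.inr ⟨rfl, rfl⟩⟩

/-- A colouring with at least three colours and few bichromatic pairs has exactly three colours,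
two of which occur only once. -/
theorem exists_singleton_colours {ι κ : Type*} [Fintype ι] [DecidableEq ι] [DecidableEq κ]
    {c : ι → κ} (h3 : ∃ i j k, c i ≠ c j ∧ c i ≠ c k ∧ c j ≠ c k)
    (hP : ({x | c x.1 ≠ c x.2} : Finset (ι × ι)).card + 6 ≤ 4 * Fintype.card ι) :
    ∃ a b, c a ≠ c b ∧ (∀ i, i ≠ a → c i ≠ c a) ∧ (∀ i, i ≠ b → c i ≠ c b) ∧
      ∀ i j, i ≠ a → i ≠ b → j ≠ a → j ≠ b → c i = c j := by
  set F : ι → Finset ι := fun i => {j | c i = c j}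
  obtain ⟨x, y, z, hxy, hxz, hyz⟩ := h3
  have hthird : ∀ i j, ∃ k, c k ≠ c i ∧ c k ≠ c j := by
    intro i j
    by_contra! H
    have hx := H x
    have hy := H y
    have hz := H z
    by_cases h1 : c x = c i <;> by_cases h2 : c y = c i <;> by_cases h3 : c z = c i <;> grind
  obtain ⟨m, -, hm⟩ := Finset.exists_max_image Finset.univ (fun i => (F i).card)
    ⟨x, Finset.mem_univ _⟩
  have hcount : ({x | c x.1 ≠ c x.2} : Finset (ι × ι)).card + ∑ i, (F i).card =
      Fintype.card ι * Fintype.card ι := by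
    rw [← Fintype.card_prod, ← Finset.card_univ,
      ← Finset.card_filter_add_card_filter_not (s := (Finset.univ : Finset (ι × ι)))
        (fun x => c x.1 = c x.2), add_comm]
    congr 1
    rw [Finset.card_filter, ← Finset.univ_product_univ, Finset.sum_product]
    exact Finset.sum_congr rfl fun i _ => Finset.card_filter _ _
  have hA : ∀ i ∈ F m, (F i).card = (F m).card := by
    intro i hi
    have : c m = c i := (Finset.mem_filter.1 hi).2
    simp only [F, this]
  -- A class outside the largest one misses a point of the complement, because a third colour
  -- exists.
  have hAc : ∀ i ∈ (F m)ᶜ, (F i).card + 1 ≤ ((F m)ᶜ).card := by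
    intro i hi
    have hi' : c m ≠ c i := by simpa [F] using hi
    obtain ⟨k, hk1, hk2⟩ := hthird m i
    rw [← Finset.card_insert_of_notMem (show k ∉ F i by simpa [F] using hk2.symm)]
    refine Finset.card_le_card fun l hl => ?_
    simp only [F, Finset.mem_insert, Finset.mem_filter, Finset.mem_univ, true_and,
      Finset.mem_compl] at hl ⊢
    rcases hl with rfl | hl
    · exact hk1.symm
    · exact fun h => hi' (h.trans hl.symm)
  have hself : ∀ i, 0 < (F i).card := fun i => Finset.card_pos.2 ⟨i, by simp [F]⟩
  have hsum : ∑ i, (F i).card = (F m).card * (F m).card + ∑ i ∈ (F m)ᶜ, (F i).card := by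
    rw [← Finset.sum_add_sum_compl (F m), Finset.sum_congr rfl hA, Finset.sum_const, smul_eq_mul]
  have hn := Finset.card_add_card_compl (F m)
  obtain ⟨k, hk, -⟩ := hthird m m
  have hkc : k ∈ (F m)ᶜ := by simpa [F] using hk.symm
  have hb2 : ((F m)ᶜ).card = 2 := by
    have hb : 2 ≤ ((F m)ᶜ).card := by
      have := hAc k hkc
      have := hself k
      omega
    have hs1 : ∑ i ∈ (F m)ᶜ, (F i).card ≤ ((F m)ᶜ).card * (F m).card :=
      (Finset.sum_le_card_nsmul _ _ _ fun i _ => hm i (Finset.mem_univ i)).trans_eq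
        (smul_eq_mul ..)
    have hs2 : ∑ i ∈ (F m)ᶜ, (F i).card ≤ ((F m)ᶜ).card * (((F m)ᶜ).card - 1) :=
      (Finset.sum_le_card_nsmul _ _ _ fun i hi => Nat.le_sub_one_of_lt (hAc i hi)).trans_eq
        (smul_eq_mul ..)
    have ha := hself m
    generalize (F m).card = a at *
    generalize ((F m)ᶜ).card = b at *
    generalize ∑ i ∈ (F m)ᶜ, (F i).card = S at *
    obtain ⟨d, rfl⟩ : ∃ d, b = d + 2 := ⟨b - 2, by omega⟩
    rw [hsum, ← hn] at hcount
    rw [← hn] at hP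
    rw [show d + 2 - 1 = d + 1 from rfl] at hs2
    rcases Nat.eq_zero_or_pos d with rfl | hd
    · rfl
    exfalso
    -- The number of bichromatic pairs is 2ab + b² - S and at most 4(a + b) - 6. By `hs2` it is at
    -- least 2ab + b, so 2a(b - 2) ≤ 3(b - 2), which excludes a ≥ 2. If a = 1, `hs1` gives b² + b ≤
    -- 4b - 2, which excludes b ≥ 3.
    rcases (by omega : a = 1 ∨ 2 ≤ a) with rfl | ha
    · nlinarith
    · nlinarith [Nat.mul_le_mul ha hd]
  obtain ⟨a, b, hab, hab'⟩ := Finset.card_eq_two.1 hb2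
  have hmem : ∀ i, c m ≠ c i ↔ i = a ∨ i = b := by
    intro i
    have : i ∈ (F m)ᶜ ↔ i ∈ ({a, b} : Finset ι) := by rw [hab']
    simpa [F] using this
  have ha := (hmem a).2 (Or.inl rfl)
  have hb := (hmem b).2 (Or.inr rfl)
  have hcab : c a ≠ c b := by
    obtain ⟨k, hk1, hk2⟩ := hthird m a
    rcases (hmem k).1 hk1.symm with rfl | rfl
    · exact absurd rfl hk2
    · exact hk2.symm
  refine ⟨a, b, hcab, fun i hi h => ?_, fun i hi h => ?_, fun i j hia hib hja hjb => ?_⟩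
  · rcases (hmem i).1 (h ▸ ha) with rfl | rfl
    · exact hi rfl
    · exact hcab h.symm
  · rcases (hmem i).1 (h ▸ hb) with rfl | rfl
    · exact hcab h
    · exact hi rfl
  · have hi : c m = c i := by_contra fun h => ((hmem i).1 h).elim hia hib
    have hj : c m = c j := by_contra fun h => ((hmem j).1 h).elim hja hjb
    exact hi.symm.trans hj

theorem IsMinimalMatroid.isEhrhartPolynomial {n : ℕ} (hn : 3 ≤ n) {T : Matroid (Fin n)}
    (hT : IsMinimalMatroid 2 n T) :
    IsEhrhartPolynomial (basisPolytope T) ((ehrMinimalShift n).comp (Polynomial.X + 1)) := by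
  classical
  obtain ⟨⟨hE, hr, hconn⟩, hmin⟩ := hT
  have hr : T.eRank = 2 := hr
  have : Fintype T.E := Fintype.ofFinite _
  have hcard : Fintype.card T.E = n := by
    rw [← Nat.card_eq_fintype_card, Nat.card_coe_set_eq, hE, Set.ncard_univ, Nat.card_fin]
  have hnt : T.E.Nontrivial := by
    rw [hE]
    exact ⟨⟨0, by omega⟩, trivial, ⟨1, by omega⟩, trivial, by simp [Fin.ext_iff]⟩
  have hl : ∀ e ∈ T.E, T.Indep {e} := fun e he => hconn.indep_singleton hnt he
  have hB := isBase_iff_parallelClass_ne hl hr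
  obtain ⟨M, hM, hMn⟩ := exists_isConnectedOfRank_two hn
  have hP := two_mul_ncard_isBase hB
  have hle := (hmin M hM).trans hMn
  -- Minimality bounds the number of ordered pairs by 2(2n - 3) = 4n - 6.
  obtain ⟨a, b, hab, ha, hb, hc⟩ := exists_singleton_colours
    (hconn.exists_three_parallelClass hr hl) (by omega)
  refine isEhrhartPolynomial_basisPolytope hB fun t => ?_
  rw [card_rankTwoPoints_of_minimal hab ha hb hc (by omega), hcard]

end Minimal

theorem mainTheorem5 :
    (∀ (n : ℕ) (hn : 3 ≤ n) (T : Matroid (Fin n)), IsMinimalMatroid 2 n T →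
      ∃ u v : Polynomial ℚ,
        IsEhrhartPolynomial (basisPolytope (uniformMatroid 2 n (by omega))) u ∧
        IsEhrhartPolynomial (basisPolytope T) v ∧
        HasPositiveCoeffs
          (u - Polynomial.C ((n / 2 : ℕ) : ℚ) * v.comp (Polynomial.X - 1))) ∧
    (∀ {α : Type*} (M : Matroid α) [M.Finite],
      M.eRank = 2 → IsSparsePaving M → IsEhrhartPositive M) := by
  refine ⟨fun n hn T hT => ⟨_, _, isEhrhartPolynomial_uniformMatroid (by omega),
    hT.isEhrhartPolynomial hn, ?_⟩, fun M _ hr hM => hM.isEhrhartPositive hr⟩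
  have h : (Polynomial.X + 1 : Polynomial ℚ).comp (Polynomial.X - 1) = Polynomial.X := by simp
  rw [Polynomial.comp_assoc, h, Polynomial.comp_X]
  exact hasPositiveCoeffs_ehrUniform_sub hn le_rfl
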